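/- Let $\mathbf X=(X_t)_{t\in\mathbb R}$ be a real stochastic process on a probability space $(\Omega,\mathcal F,P)$, put $\mathcal F_{\le s}=\sigma(X_r:r\le s)$, and assume the following. (a) (Stationary Markov.) All $X_t$ have the same law $\mu$, and there are probability kernels $\eta(\cdot\mid y,\tau)$, $\tau>0$, on $\mathbb R$ with $P(X_{s+\tau}\in B\mid\mathcal F_{\le s})=\eta(B\mid X_s,\tau)$ a.s. for all $s\in\mathbb R$, $\tau>0$ and Borel sets $B$. The law $\mu$ has all moments and is determined by them. Let $\nu\in\{1,2,\dots\}\cup\{\infty\}$ be the number of points of $\operatorname{supp}\mu$. (b) For all integers $n<\nu$ and distinct times $s_1,\dots,s_n$ the matrix $[\operatorname{cov}(X_{s_i},X_{s_j})]_{i,j\le n}$ is non-singular, and for all $m,j\ge 0$ and all $s$, $E X_t^mX_s^j\to E X_s^{m+j}$ as $t\to s$. (c) (Polynomial regression.) For all $n\ge 0$, $s\in\mathbb R$ and $\tau>0$, $E(X_{s+\tau}^n\mid\mathcal F_{\le s})=\sum_{j=0}^n\gamma_{n,j}(\tau)X_s^j$ a.s., with real coefficients $\gamma_{n,j}(\tau)$.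 Let $\mathbf A_n(\tau)$ be the lower triangular $(n+1)\times(n+1)$ matrix with entries $\gamma_{i,j}(\tau)$, $0\le j\le i\le n$. (d) (Regularity.) There are real numbers $\alpha_n$ and polynomials $h_n$ of degree $n$ ($0\le n<\nu$), with $h_0=1$, orthonormal in $L_2(\mu)$, such that for all $n<\nu$ and $\tau>0$, $\mathbf A_n(\tau)=\mathbf V_n\operatorname{diag}(e^{-\alpha_0\tau},\dots,e^{-\alpha_n\tau})\mathbf V_n^{-1}$, where $\mathbf V_n^{-1}(1,x,\dots,x^n)^T=(h_0(x),\dots,h_n(x))^T$. Suppose that $\operatorname{supp}\mu$ is bounded and that for every $t>0$ $$\sum_{0\le n<\nu}e^{-\alpha_nt}\sup_{x\in\operatorname{supp}\mu}|h_n(x)|<\infty .$$ Then the family of transition probabilities is Feller: there is a semigroup $(\kappa_t)_{t\ge0}$ of probability kernels on $S=\operatorname{supp}\mu$, with $\kappa_0(y,\cdot)=\delta_y$, such that $\eta(\cdot\mid y,t)=\kappa_t(y,\cdot)$ for every $t>0$ and $\mu$-almost every $y$, and such that $f\mapsto\int f(z)\,\kappa_t(\cdot,dz)$ maps $C_0(S)$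 into itself and converges to $f$ uniformly on $S$ as $t\to0$, for every $f\in C_0(S)$ (which is the space $C(S)$ of all continuous functions, since $S$ is compact). Consequently the process has the strong Markov property: $\mathbf X$ has a modification with values in $S$ and right-continuous paths with left limits, and every modification $\mathbf Y$ of $\mathbf X$ with right-continuous paths (in particular $\mathbf X$ itself, if its paths are right-continuous) is strong Markov, that is, with $\mathcal F^Y_{t+}=\bigcap_{u>t}\sigma(Y_r:r\le u)$, for every stopping time $\tau:\Omega\to\mathbb R\cup\{+\infty\}$ of $(\mathcal F^Y_{t+})_{t\in\mathbb R}$, every $t\ge0$ and every Borel set $B\subseteq\mathbb R$, $$P(\tau<\infty,\ Y_{\tau+t}\in B\mid\mathcal F^Y_{\tau+})=\mathbf 1_{\{\tau<\infty\}}\,\kappa_t(Y_\tau,B\cap S)\quad\text{a.s.}$$ -/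

import Mathlib

open MeasureTheory ProbabilityTheory Filter Topology
open scoped NNReal ENNReal ZeroAtInfty

noncomputable section

namespace StatMarkov

/-- The sigma-algebra generated by the variables `X r`, `r ≤ s`. -/
abbrev past {Ω : Type*} (X : ℝ → Ω → ℝ) (s : ℝ) : MeasurableSpace Ω :=
  ⨆ r : ℝ, ⨆ _ : r ≤ s, MeasurableSpace.comap (X r) inferInstance

/-- The number of points (possibly infinite) of the support of `μ`. -/
def suppCard (μ : Measure ℝ) : ℕ∞ := μ.support.encard

/-- Stationary Markov processes with polynomial regression (SMPR) in continuous time: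
`μ` is the common law of the `X t`, `η τ y` is the conditional law of `X (s + τ)` given `X s = y`,
and `γ n j τ` are the coefficients of the conditional moments
`E (X (s + τ) ^ n | past) = ∑ j ≤ n, γ n j τ * (X s) ^ j`. -/
structure IsSMPR {Ω : Type*} [MeasurableSpace Ω] (P : Measure Ω) (X : ℝ → Ω → ℝ)
    (μ : Measure ℝ) (η : ℝ≥0 → Kernel ℝ ℝ) (γ : ℕ → ℕ → ℝ≥0 → ℝ) : Prop where
  measurable : ∀ t, Measurable (X t)
  /-- stationarity of the marginals -/
  law : ∀ t, P.map (X t) = μ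
  kernel : ∀ τ : ℝ≥0, 0 < τ → IsMarkovKernel (η τ)
  /-- Markov property with time-homogeneous transition probabilities `η` -/
  markov : ∀ (s : ℝ) (τ : ℝ≥0), 0 < τ → ∀ B : Set ℝ, MeasurableSet B →
    P[(X (s + τ) ⁻¹' B).indicator (fun _ => (1 : ℝ)) | past X s]
      =ᵐ[P] fun ω => (η τ (X s ω)).real B
  moments : ∀ n : ℕ, Integrable (fun x : ℝ => x ^ n) μ
  /-- `μ` is identified by its moments -/
  determinate : ∀ ρ : Measure ℝ, IsProbabilityMeasure ρ →
    (∀ n : ℕ, Integrable (fun x : ℝ => x ^ n) ρ) →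
    (∀ n : ℕ, ∫ x, x ^ n ∂ρ = ∫ x, x ^ n ∂μ) → ρ = μ
  /-- total linear dependence -/
  tld : ∀ n : ℕ, (n : ℕ∞) < suppCard μ → ∀ s : Fin n → ℝ, Function.Injective s →
    (Matrix.of fun i j : Fin n => cov[X (s i), X (s j); P]).det ≠ 0
  /-- mean-square continuity -/
  msc : ∀ (m j : ℕ) (s : ℝ),
    Tendsto (fun t => ∫ ω, X t ω ^ m * X s ω ^ j ∂P) (𝓝 s) (𝓝 (∫ ω, X s ω ^ (m + j) ∂P))
  /-- polynomial regression -/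
  regression : ∀ (n : ℕ) (s : ℝ) (τ : ℝ≥0), 0 < τ →
    P[fun ω => X (s + τ) ω ^ n | past X s]
      =ᵐ[P] fun ω => ∑ j ∈ Finset.range (n + 1), γ n j τ * X s ω ^ j

/-- The structural matrix `A_n(t)`: lower triangular, of size `n + 1`, with entries `γ i j t`. -/
def structuralMatrix (γ : ℕ → ℕ → ℝ≥0 → ℝ) (n : ℕ) (t : ℝ≥0) :
    Matrix (Fin (n + 1)) (Fin (n + 1)) ℝ :=
  Matrix.of fun i j => if j ≤ i then γ i j t else 0

/-- The matrix `C` whose `i`-th row consists of the coefficients of the polynomial `h i`, so that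
`C (1, x, …, x ^ n)ᵀ = (h 0 x, …, h n x)ᵀ`. -/
def coeffMatrix (h : ℕ → Polynomial ℝ) (n : ℕ) : Matrix (Fin (n + 1)) (Fin (n + 1)) ℝ :=
  Matrix.of fun i j => (h i).coeff j

/-- Regular SMPR processes with correlation indices `α n` and polynomials `h n`: the structural
matrices are diagonalized as `A_n(t) = V_n diag(exp(-α_0 t), …, exp(-α_n t)) V_n⁻¹`, where
`V_n⁻¹ (1, x, …, x ^ n)ᵀ = (h_0 x, …, h_n x)ᵀ`, and the `h n`, with `h n` of degree `n`, are
orthonormal for the stationary law `μ`. If the support of `μ` has `ν` points, only the indices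
`n < ν` are considered. -/
structure IsRSMPR {Ω : Type*} [MeasurableSpace Ω] (P : Measure Ω) (X : ℝ → Ω → ℝ)
    (μ : Measure ℝ) (η : ℝ≥0 → Kernel ℝ ℝ) (γ : ℕ → ℕ → ℝ≥0 → ℝ)
    (α : ℕ → ℝ) (h : ℕ → Polynomial ℝ) : Prop extends IsSMPR P X μ η γ where
  h_zero : h 0 = 1
  degree : ∀ n : ℕ, (n : ℕ∞) < suppCard μ → (h n).natDegree = n
  orthonormal : ∀ m n : ℕ, (m : ℕ∞) < suppCard μ → (n : ℕ∞) < suppCard μ →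
    ∫ x, (h m).eval x * (h n).eval x ∂μ = if m = n then 1 else 0
  diagonalization : ∀ n : ℕ, (n : ℕ∞) < suppCard μ → ∀ t : ℝ≥0, 0 < t →
    structuralMatrix γ n t =
      (coeffMatrix h n)⁻¹ * Matrix.diagonal (fun i : Fin (n + 1) => Real.exp (-α i * t)) *
        coeffMatrix h n

/-- Feller transition functions on a topological space `E`: a semigroup of Markov kernels which
maps `C₀(E, ℝ)` to itself and is strongly continuous there for the uniform norm. -/
structure IsFeller {E : Type*} [TopologicalSpace E] [MeasurableSpace E]
    (κ : ℝ≥0 → Kernel E E) : Prop where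
  markovKernel : ∀ t, IsMarkovKernel (κ t)
  zero : κ 0 = Kernel.id
  add : ∀ s t, κ (s + t) = κ t ∘ₖ κ s
  map_C0 : ∀ (t : ℝ≥0) (f : C₀(E, ℝ)), ∃ g : C₀(E, ℝ), ∀ x, g x = ∫ y, f y ∂κ t x
  strongly_continuous : ∀ f : C₀(E, ℝ),
    TendstoUniformly (fun (t : ℝ≥0) (x : E) => ∫ y, f y ∂κ t x) f (𝓝 0)

open Classical in
/-- A transition kernel on `S ⊆ ℝ`, viewed as a family of measures on `ℝ`: points of `S` are
treated by the kernel, and points outside the state space `S` do not move. -/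
def onReal {S : Set ℝ} (κ : Kernel S S) (y : ℝ) : Measure ℝ :=
  if hy : y ∈ S then (κ ⟨y, hy⟩).map Subtype.val else Measure.dirac y

/-- `Y` is a modification of `X`. -/
def IsModification {Ω : Type*} [MeasurableSpace Ω] (P : Measure Ω) (Y X : ℝ → Ω → ℝ) : Prop :=
  ∀ t, Y t =ᵐ[P] X t

/-- Right-continuous paths. -/
def RightContinuousPaths {Ω : Type*} (Y : ℝ → Ω → ℝ) : Prop :=
  ∀ ω t, ContinuousWithinAt (fun r => Y r ω) (Set.Ici t) t

/-- Existence of left limits of the paths. -/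
def LeftLimitPaths {Ω : Type*} (Y : ℝ → Ω → ℝ) : Prop :=
  ∀ ω t, ∃ l : ℝ, Tendsto (fun r => Y r ω) (𝓝[<] t) (𝓝 l)

/-- The natural filtration `σ(Y r : r ≤ s)`, made right-continuous. -/
def naturalPlus {Ω : Type*} {mΩ : MeasurableSpace Ω} (Y : ℝ → Ω → ℝ)
    (hY : ∀ t, Measurable (Y t)) : Filtration ℝ mΩ :=
  (Filtration.natural Y fun t => (hY t).stronglyMeasurable).rightCont

/-- The strong Markov property with transition probabilities `q`: for every stopping time `τ` of
the right-continuous natural filtration (with values in `ℝ ∪ {+∞}`), every `t ≥ 0` and Borel `B`,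
on `{τ < ∞}` the conditional probability of `Y (τ + t) ∈ B` given `F_{τ+}` is `q t (Y τ) B`. -/
def HasStrongMarkov {Ω : Type*} {mΩ : MeasurableSpace Ω} (P : Measure Ω) (Y : ℝ → Ω → ℝ)
    (hY : ∀ t, Measurable (Y t)) (q : ℝ≥0 → ℝ → Measure ℝ) : Prop :=
  ∀ (τ : Ω → WithTop ℝ) (hτ : IsStoppingTime (naturalPlus Y hY) τ) (t : ℝ≥0) (B : Set ℝ),
    MeasurableSet B →
    P[{ω | τ ω ≠ ⊤ ∧ Y ((τ ω).untopA + t) ω ∈ B}.indicator (fun _ => (1 : ℝ)) |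
        hτ.measurableSpace]
      =ᵐ[P] {ω | τ ω ≠ ⊤}.indicator fun ω => (q t (Y (τ ω).untopA ω)).real B

end StatMarkov

end

/-! Regularity says that the polynomials `h n` are eigenfunctions of the regression operators:
E(h_n(X_{s+t}) | past) = e^{-α_n t} h_n(X_s) (`IsRSMPR.condExp_eval`). They are orthonormal, and by
Weierstrass their span is dense in C(S), where S = supp μ is compact. So the transition density with
respect to μ has to be p_t(x, y) = ∑ e^{-α_n t} h_n(x) h_n(y). Summability at time t/2 makes this
series converge uniformly on S × S, hence p_t is continuous. For almost every x, p_t(x, ·)μ and η(·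
| x, t) integrate every h_n alike, so they coincide and p_t(x, ·) ≥ 0. Continuity and the full
support of μ extend positivity to every x (`IsSpectralSystem.spectralDensity_nonneg`). This turns
transition probabilities known almost everywhere into kernels defined at every point of S. Their
semigroup law and strong continuity are checked on the h_n (`IsSpectralSystem.isFeller`).

For the paths, e^{α_1 t} h_1(X_t) is a martingale and h_1 is affine and non-constant, so Doob's
upcrossing inequality gives X one-sided limits along the dyadic numbers
(`ae_exists_tendsto_dyadic`). The right limits form the modification, and mean-square continuity
identifies them with X_t almost surely.

For the strong Markov property, a stopping time is approximated from above by dyadic-valued times.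
The simple Markov property applies on each piece where the approximation is constant
(`map_dyadicAbove_eq_comp`). Right-continuity and the Feller property then allow passage to the
limit (`map_stoppedValue_eq_comp`). -/

noncomputable section

namespace StatMarkov

set_option linter.unusedSectionVars false

/-! ### Feller kernels from a system of continuous eigenfunctions -/

section Spectral

variable {E ι : Type*} [MetricSpace E] [CompactSpace E] [MeasurableSpace E] [BorelSpace E]

/-- An orthonormal system of continuous functions `e i` with dense span which, for almost every
starting point `x`, are eigenfunctions with eigenvalues `exp (-α i * t)` of some probability
measure representing a transition probability from `x` in time `t`. -/
structure IsSpectralSystem (m : Measure E) (e : ι → C(E, ℝ)) (α : ι → ℝ) : Prop where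
  orthogonal : ∀ i j, i ≠ j → ∫ x, e i x * e j x ∂m = 0
  normalized : ∀ i, ∫ x, e i x * e i x ∂m = 1
  summable : ∀ t : ℝ, 0 < t → Summable fun i => Real.exp (-α i * t) * ‖e i‖
  dense : (Submodule.span ℝ (Set.range e)).topologicalClosure = ⊤
  one : ∃ i, e i = 1 ∧ α i = 0
  regression : ∀ t : ℝ, 0 < t → ∀ᵐ x ∂m, ∃ ρ : Measure E, IsProbabilityMeasure ρ ∧
    ∀ i, ∫ y, e i y ∂ρ = Real.exp (-α i * t) * e i x

/-- The transition density with eigenfunctions `e i` and eigenvalues `exp (-α i * t)`. -/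
def spectralDensity (e : ι → C(E, ℝ)) (α : ι → ℝ) (t : ℝ) (x y : E) : ℝ :=
  ∑' i, Real.exp (-α i * t) * (e i x * e i y)

lemma integrable_continuousMap (m : Measure E) [IsFiniteMeasure m] (f : C(E, ℝ)) :
    Integrable (fun x => f x) m :=
  (BoundedContinuousFunction.mkOfCompact f).integrable m

lemma abs_integral_continuousMap_le (m : Measure E) [IsProbabilityMeasure m] (f : C(E, ℝ)) :
    |∫ x, f x ∂m| ≤ ‖f‖ := by
  have := norm_integral_le_of_norm_le_const (μ := m) (f := fun x => f x) (C := ‖f‖)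
    (Eventually.of_forall fun x => f.norm_coe_le_norm x)
  simpa using this

/-- Integration of `f` against the density `g`, as a continuous linear functional of `f`. -/
def integralMulCLM (m : Measure E) [IsFiniteMeasure m] (g : C(E, ℝ)) : C(E, ℝ) →L[ℝ] ℝ :=
  LinearMap.mkContinuous
    { toFun := fun f => ∫ x, f x * g x ∂m
      map_add' := fun f f' => by
        simp only [ContinuousMap.add_apply, add_mul]
        exact integral_add (integrable_continuousMap m (f * g)) (integrable_continuousMap m (f' * g))
      map_smul' := fun c f => by
        simp only [ContinuousMap.smul_apply, smul_eq_mul, mul_assoc, RingHom.id_apply]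
        exact integral_const_mul c _ }
    (‖g‖ * m.real Set.univ) fun f => by
      have := norm_integral_le_of_norm_le_const (μ := m) (f := fun x => f x * g x) (C := ‖f‖ * ‖g‖)
        (Eventually.of_forall fun x => by
          rw [norm_mul]
          exact mul_le_mul (f.norm_coe_le_norm x) (g.norm_coe_le_norm x) (norm_nonneg _)
            (norm_nonneg _))
      calc ‖∫ x, f x * g x ∂m‖ ≤ ‖f‖ * ‖g‖ * m.real Set.univ := this
        _ = ‖g‖ * m.real Set.univ * ‖f‖ := by ring

lemma integralMulCLM_apply (m : Measure E) [IsFiniteMeasure m] (g f : C(E, ℝ)) :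
    integralMulCLM m g f = ∫ x, f x * g x ∂m := rfl

lemma integralMulCLM_one_apply (m : Measure E) [IsFiniteMeasure m] (f : C(E, ℝ)) :
    integralMulCLM m 1 f = ∫ x, f x ∂m := by
  simp [integralMulCLM_apply]

lemma clm_ext_of_dense {e : ι → C(E, ℝ)}
    (hd : (Submodule.span ℝ (Set.range e)).topologicalClosure = ⊤) {F G : C(E, ℝ) →L[ℝ] ℝ}
    (h : ∀ i, F (e i) = G (e i)) : F = G := by
  refine ContinuousLinearMap.ext_on (s := Set.range e) ?_ ?_
  · rwa [← Submodule.dense_iff_topologicalClosure_eq_top] at hd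
  · rintro _ ⟨i, rfl⟩
    exact h i

lemma measure_ext_of_dense {e : ι → C(E, ℝ)}
    (hd : (Submodule.span ℝ (Set.range e)).topologicalClosure = ⊤) {m m' : Measure E}
    [IsFiniteMeasure m] [IsFiniteMeasure m'] (h : ∀ i, ∫ x, e i x ∂m = ∫ x, e i x ∂m') :
    m = m' := by
  have key : integralMulCLM m 1 = integralMulCLM m' 1 :=
    clm_ext_of_dense hd fun i => by simpa only [integralMulCLM_one_apply] using h i
  refine ext_of_forall_integral_eq_of_IsFiniteMeasure fun f => ?_
  have := DFunLike.congr_fun key f.toContinuousMap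
  rwa [integralMulCLM_one_apply, integralMulCLM_one_apply] at this

namespace IsSpectralSystem

variable {m : Measure E} {e : ι → C(E, ℝ)} {α : ι → ℝ}

/-- Splitting the exponential evenly, each term is the square of a term of the summable series at
time t/2, and one of the two factors is bounded by the sum of that series. -/
lemma summable_norm_sq (h : IsSpectralSystem m e α) {t : ℝ} (ht : 0 < t) :
    Summable fun i => Real.exp (-α i * t) * (‖e i‖ * ‖e i‖) := by
  have hs := h.summable (t / 2) (half_pos ht)
  have hn : ∀ i, 0 ≤ Real.exp (-α i * (t / 2)) * ‖e i‖ := fun i => by positivity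
  refine Summable.of_nonneg_of_le (fun i => by positivity) (fun i => ?_)
    (hs.mul_left (∑' i, Real.exp (-α i * (t / 2)) * ‖e i‖))
  have h1 := hs.le_tsum i fun j _ => hn j
  have h2 : Real.exp (-α i * t) = Real.exp (-α i * (t / 2)) * Real.exp (-α i * (t / 2)) := by
    rw [← Real.exp_add]
    ring_nf
  calc _ = (Real.exp (-α i * (t / 2)) * ‖e i‖) * (Real.exp (-α i * (t / 2)) * ‖e i‖) := by
        rw [h2]
        ring
    _ ≤ _ := mul_le_mul_of_nonneg_right h1 (hn i)

lemma norm_term_le (i : ι) (t : ℝ) (x y : E) :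
    ‖Real.exp (-α i * t) * (e i x * e i y)‖ ≤ Real.exp (-α i * t) * (‖e i‖ * ‖e i‖) := by
  rw [norm_mul, norm_mul, Real.norm_of_nonneg (Real.exp_pos _).le]
  gcongr
  · exact (e i).norm_coe_le_norm x
  · exact (e i).norm_coe_le_norm y

lemma continuous_spectralDensity (h : IsSpectralSystem m e α) {t : ℝ} (ht : 0 < t) :
    Continuous fun p : E × E => spectralDensity e α t p.1 p.2 := by
  refine continuous_tsum (fun i => by fun_prop) (h.summable_norm_sq ht) fun i p => ?_
  exact norm_term_le i t p.1 p.2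

/-- The transition density started from `x`. -/
def densityMap (h : IsSpectralSystem m e α) {t : ℝ} (ht : 0 < t) (x : E) : C(E, ℝ) :=
  ⟨fun y => spectralDensity e α t x y,
    (h.continuous_spectralDensity ht).comp (Continuous.prodMk_right x)⟩

variable [Countable ι] [IsProbabilityMeasure m]

lemma integral_mul_spectralDensity (h : IsSpectralSystem m e α) {t : ℝ} (ht : 0 < t) (x : E)
    (i : ι) : ∫ y, e i y * spectralDensity e α t x y ∂m = Real.exp (-α i * t) * e i x := by
  have h1 : ∀ y, e i y * spectralDensity e α t x y
      = ∑' j, (Real.exp (-α j * t) * e j x) * (e i y * e j y) := by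
    intro y
    rw [spectralDensity, ← tsum_mul_left]
    congr 1
    ext j
    ring
  have hint : ∀ j, Integrable (fun y => (Real.exp (-α j * t) * e j x) * (e i y * e j y)) m :=
    fun j => (integrable_continuousMap m (e i * e j)).const_mul _
  have hsum : Summable fun j => ∫ y, ‖(Real.exp (-α j * t) * e j x) * (e i y * e j y)‖ ∂m := by
    refine Summable.of_nonneg_of_le (fun j => integral_nonneg fun y => norm_nonneg _)
      (fun j => ?_) ((h.summable_norm_sq ht).mul_left ‖e i‖)
    have := norm_integral_le_of_norm_le_const (μ := m)
      (f := fun y => ‖(Real.exp (-α j * t) * e j x) * (e i y * e j y)‖)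
      (C := ‖e i‖ * (Real.exp (-α j * t) * (‖e j‖ * ‖e j‖)))
      (Eventually.of_forall fun y => by
        rw [norm_norm, show Real.exp (-α j * t) * e j x * (e i y * e j y)
          = e i y * (Real.exp (-α j * t) * (e j x * e j y)) by ring, norm_mul]
        exact mul_le_mul ((e i).norm_coe_le_norm y) (norm_term_le j t x y) (norm_nonneg _)
          (norm_nonneg _))
    simpa using (le_abs_self _).trans this
  simp_rw [h1]
  rw [← integral_tsum_of_summable_integral_norm hint hsum]
  simp_rw [integral_const_mul]
  rw [tsum_eq_single i fun j hj => by rw [h.orthogonal i j hj.symm, mul_zero], h.normalized,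
    mul_one]

/-- For almost every starting point the density represents a probability measure ρ, because both
give the same integrals of all `e i`. Positivity then spreads to all starting points by continuity.
-/
lemma spectralDensity_nonneg [m.IsOpenPosMeasure] (h : IsSpectralSystem m e α) {t : ℝ}
    (ht : 0 < t) (x y : E) : 0 ≤ spectralDensity e α t x y := by
  have hae : ∀ᵐ x ∂m, ∀ y, 0 ≤ spectralDensity e α t x y := by
    filter_upwards [h.regression t ht] with x ⟨ρ, hρ, hi⟩
    set p := h.densityMap ht x with hp
    have key : integralMulCLM m p = integralMulCLM ρ 1 := by
      refine clm_ext_of_dense h.dense fun i => ?_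
      rw [integralMulCLM_apply, integralMulCLM_one_apply, hi]
      exact h.integral_mul_spectralDensity ht x i
    -- Test with the negative part q of p: since q p = -q², one gets -∫ q² dm = ∫ q dρ ≥ 0, so q
    -- vanishes m-almost everywhere, and everywhere by continuity.
    let q : C(E, ℝ) := ⟨fun y => max (-p y) 0, by fun_prop⟩
    have hq : ∫ y, q y * p y ∂m = ∫ y, q y ∂ρ := by
      rw [← integralMulCLM_apply, key, integralMulCLM_one_apply]
    have hqp : ∀ y, q y * p y = -(q y * q y) := fun y => by
      change max (-p y) 0 * p y = -(max (-p y) 0 * max (-p y) 0)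
      rcases le_total (-p y) 0 with hy | hy
      · simp [max_eq_right hy]
      · simp [max_eq_left hy]
    have h0 : ∫ y, (q * q) y ∂m = 0 := by
      refine le_antisymm ?_ (integral_nonneg fun y => mul_self_nonneg (q y))
      simp_rw [hqp, integral_neg] at hq
      have : 0 ≤ ∫ y, q y ∂ρ := integral_nonneg fun y => le_max_right _ _
      have : ∫ y, (q * q) y ∂m = ∫ y, q y * q y ∂m := rfl
      linarith
    have h1 := (integral_eq_zero_iff_of_nonneg (fun y => mul_self_nonneg (q y))
      (integrable_continuousMap m (q * q))).1 h0
    have h2 := ((q * q).continuous.ae_eq_iff_eq m continuous_zero).1 h1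
    intro y
    have h3 : q y = 0 := mul_self_eq_zero.1 (congrFun h2 y)
    have h4 : -p y ≤ 0 := h3 ▸ le_max_left (-p y) 0
    exact neg_nonpos.1 h4
  have hd := Measure.dense_of_ae hae
  have hcl : IsClosed {x | ∀ y, 0 ≤ spectralDensity e α t x y} := by
    simp only [Set.ofPred_forall]
    exact isClosed_iInter fun y => isClosed_le continuous_const
      ((h.continuous_spectralDensity ht).comp (Continuous.prodMk_left y))
  have := hd.closure_eq
  rw [hcl.closure_eq] at this
  exact (this ▸ Set.mem_univ x : x ∈ {x | ∀ y, 0 ≤ spectralDensity e α t x y}) y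

/-- The transition kernels with eigenfunctions `e i` and eigenvalues `exp (-α i * t)`. -/
def kernel (m : Measure E) (e : ι → C(E, ℝ)) (α : ι → ℝ) [IsProbabilityMeasure m] (t : ℝ≥0) :
    Kernel E E :=
  -- The series need not converge at time 0, so the identity kernel is prescribed there.
  if t = 0 then Kernel.id
  else Kernel.withDensity (Kernel.const E m)
    fun x y => ENNReal.ofReal (spectralDensity e α t x y)

lemma kernel_zero : kernel m e α 0 = Kernel.id := by simp [kernel]

lemma measurable_density (h : IsSpectralSystem m e α) {t : ℝ} (ht : 0 < t) :
    Measurable (Function.uncurry fun x y => ENNReal.ofReal (spectralDensity e α t x y)) :=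
  (h.continuous_spectralDensity ht).measurable.ennreal_ofReal

lemma kernel_apply (h : IsSpectralSystem m e α) {t : ℝ≥0} (ht : 0 < t) (x : E) :
    kernel m e α t x = m.withDensity fun y => ENNReal.ofReal (spectralDensity e α t x y) := by
  rw [kernel, if_neg ht.ne']
  exact Kernel.withDensity_apply (Kernel.const E m) (h.measurable_density (NNReal.coe_pos.2 ht)) x

variable [m.IsOpenPosMeasure]

lemma integral_kernel (h : IsSpectralSystem m e α) {t : ℝ≥0} (ht : 0 < t) (x : E) (f : E → ℝ) :
    ∫ y, f y ∂kernel m e α t x = ∫ y, f y * spectralDensity e α t x y ∂m := by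
  have hm : Measurable fun y => ENNReal.ofReal (spectralDensity e α t x y) :=
    (h.densityMap (NNReal.coe_pos.2 ht) x).continuous.measurable.ennreal_ofReal
  rw [h.kernel_apply ht, integral_withDensity_eq_integral_toReal_smul hm
    (Eventually.of_forall fun y => ENNReal.ofReal_lt_top)]
  refine integral_congr_ae (Eventually.of_forall fun y => ?_)
  simp only [smul_eq_mul]
  rw [ENNReal.toReal_ofReal (h.spectralDensity_nonneg (NNReal.coe_pos.2 ht) x y), mul_comm]

lemma integral_kernel_eigen (h : IsSpectralSystem m e α) (t : ℝ≥0) (x : E) (i : ι) :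
    ∫ y, e i y ∂kernel m e α t x = Real.exp (-α i * t) * e i x := by
  rcases eq_zero_or_pos t with rfl | ht
  · simp [kernel_zero, Kernel.id_apply]
  · rw [h.integral_kernel ht]
    exact h.integral_mul_spectralDensity (NNReal.coe_pos.2 ht) x i

lemma isMarkovKernel_kernel (h : IsSpectralSystem m e α) (t : ℝ≥0) :
    IsMarkovKernel (kernel m e α t) := by
  rcases eq_zero_or_pos t with rfl | ht
  · rw [kernel_zero]
    infer_instance
  refine ⟨fun x => ⟨?_⟩⟩
  obtain ⟨i, hi, hα⟩ := h.one
  have h1 := h.integral_mul_spectralDensity (NNReal.coe_pos.2 ht) x i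
  simp only [hi, hα, ContinuousMap.one_apply, one_mul, neg_zero, zero_mul, Real.exp_zero] at h1
  have hint : Integrable (fun y => spectralDensity e α t x y) m :=
    integrable_continuousMap m (h.densityMap (NNReal.coe_pos.2 ht) x)
  rw [h.kernel_apply ht, withDensity_apply _ MeasurableSet.univ, Measure.restrict_univ,
    ← ofReal_integral_eq_lintegral_ofReal hint
      (Eventually.of_forall fun y => h.spectralDensity_nonneg (NNReal.coe_pos.2 ht) x y), h1, ENNReal.ofReal_one]

/-- The action of the transition kernels on continuous functions. -/
lemma exists_continuousMap (h : IsSpectralSystem m e α) (t : ℝ≥0) (f : C(E, ℝ)) :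
    ∃ g : C(E, ℝ), ∀ x, g x = ∫ y, f y ∂kernel m e α t x := by
  rcases eq_zero_or_pos t with rfl | ht
  · exact ⟨f, fun x => by simp [kernel_zero, Kernel.id_apply]⟩
  refine ⟨⟨fun x => ∫ y, f y * spectralDensity e α t x y ∂m, ?_⟩,
    fun x => (h.integral_kernel ht x f).symm⟩
  have hc : Continuous (Function.uncurry fun x y => f y * spectralDensity e α t x y) :=
    (f.continuous.comp continuous_snd).mul (h.continuous_spectralDensity (NNReal.coe_pos.2 ht))
  have := continuous_parametric_integral_of_continuous (μ := m) hc isCompact_univ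
  simpa using this

/-- On an eigenfunction the error is at most |e^{-α t} - 1| times its norm. Linearity gives the
span, and an ε/3 argument gives its closure because Markov kernels contract the uniform norm. -/
lemma tendstoUniformly (h : IsSpectralSystem m e α) (f : C(E, ℝ)) :
    TendstoUniformly (fun (t : ℝ≥0) (x : E) => ∫ y, f y ∂kernel m e α t x) f (𝓝 0) := by
  have hM := h.isMarkovKernel_kernel
  have hspan : ∀ g ∈ Submodule.span ℝ (Set.range e),
      TendstoUniformly (fun (t : ℝ≥0) (x : E) => ∫ y, g y ∂kernel m e α t x) g (𝓝 0) := by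
    intro g hg
    induction hg using Submodule.span_induction with
    | mem g hg =>
      obtain ⟨i, rfl⟩ := hg
      simp_rw [h.integral_kernel_eigen]
      have hlim : Tendsto (fun t : ℝ≥0 => Real.exp (-α i * t) - 1) (𝓝 0) (𝓝 0) := by
        have : Continuous fun t : ℝ≥0 => Real.exp (-α i * t) - 1 := by fun_prop
        simpa using this.tendsto 0
      rw [Metric.tendstoUniformly_iff]
      intro ε hε
      have h2 : Tendsto (fun t : ℝ≥0 => |Real.exp (-α i * t) - 1| * ‖e i‖) (𝓝 0) (𝓝 0) := by
        simpa using hlim.abs.mul_const ‖e i‖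
      filter_upwards [h2.eventually (gt_mem_nhds hε)] with t ht x
      rw [dist_comm, Real.dist_eq, show Real.exp (-α i * t) * e i x - e i x
        = (Real.exp (-α i * t) - 1) * e i x by ring, abs_mul]
      exact (mul_le_mul_of_nonneg_left ((e i).norm_coe_le_norm x) (abs_nonneg _)).trans_lt ht
    | zero => simp [Metric.tendstoUniformly_iff]; intros; assumption
    | add g g' _ _ hg hg' =>
      have hfun : (fun (t : ℝ≥0) (x : E) => ∫ y, (g + g') y ∂kernel m e α t x)
          = (fun t x => ∫ y, g y ∂kernel m e α t x) + fun t x => ∫ y, g' y ∂kernel m e α t x := by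
        ext t x
        exact integral_add (integrable_continuousMap _ g) (integrable_continuousMap _ g')
      rw [hfun, ContinuousMap.coe_add]
      exact hg.add hg'
    | smul c g _ hg =>
      have := (uniformContinuous_const_smul c (M := ℝ) (X := ℝ)).comp_tendstoUniformly hg
      have hfun : (fun (t : ℝ≥0) (x : E) => ∫ y, (c • g) y ∂kernel m e α t x)
          = fun t => (fun x => c • x) ∘ fun x => ∫ y, g y ∂kernel m e α t x := by
        ext t x
        exact integral_const_mul c _
      rw [hfun]
      exact this
  rw [Metric.tendstoUniformly_iff]
  intro ε hε
  obtain ⟨g, hg, hfg⟩ : ∃ g ∈ Submodule.span ℝ (Set.range e), dist f g < ε / 3 := by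
    have : f ∈ closure (Submodule.span ℝ (Set.range e) : Set C(E, ℝ)) := by
      rw [← Submodule.topologicalClosure_coe, h.dense]
      trivial
    exact Metric.mem_closure_iff.1 this (ε / 3) (by positivity)
  filter_upwards [Metric.tendstoUniformly_iff.1 (hspan g hg) (ε / 3) (by positivity)] with t ht x
  have h1 : dist (f x) (g x) < ε / 3 := (ContinuousMap.dist_apply_le_dist x).trans_lt hfg
  have h2 : dist (∫ y, g y ∂kernel m e α t x) (∫ y, f y ∂kernel m e α t x) < ε / 3 := by
    rw [Real.dist_eq, ← integral_sub (integrable_continuousMap _ g) (integrable_continuousMap _ f)]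
    refine (abs_integral_continuousMap_le (kernel m e α t x) (g - f)).trans_lt ?_
    rwa [← dist_eq_norm, dist_comm]
  calc _ ≤ dist (f x) (g x) + dist (g x) (∫ y, g y ∂kernel m e α t x)
        + dist (∫ y, g y ∂kernel m e α t x) (∫ y, f y ∂kernel m e α t x) := dist_triangle4 _ _ _ _
    _ < ε := by linarith [ht x]

/-- Both sides multiply each `e i` by the same exponential, and measures are determined by their
integrals of the `e i`. -/
lemma kernel_add (h : IsSpectralSystem m e α) (s t : ℝ≥0) :
    kernel m e α (s + t) = kernel m e α t ∘ₖ kernel m e α s := by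
  have hM := h.isMarkovKernel_kernel
  ext1 x
  refine measure_ext_of_dense h.dense fun i => ?_
  rw [Kernel.integral_comp (integrable_continuousMap _ (e i))]
  simp_rw [h.integral_kernel_eigen, integral_const_mul, h.integral_kernel_eigen]
  rw [← mul_assoc, ← Real.exp_add]
  push_cast
  ring_nf

lemma isFeller (h : IsSpectralSystem m e α) : IsFeller (kernel m e α) where
  markovKernel := h.isMarkovKernel_kernel
  zero := kernel_zero
  add := h.kernel_add
  map_C0 t f := by
    obtain ⟨g, hg⟩ := h.exists_continuousMap t f.toContinuousMap
    exact ⟨⟨g, by simp [cocompact_eq_bot]⟩, hg⟩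
  strongly_continuous f := h.tendstoUniformly f.toContinuousMap

end IsSpectralSystem

end Spectral

/-! ### The spectral system of a regular process -/

lemma integral_comp_measure {β δ : Type*} [MeasurableSpace β] [MeasurableSpace δ] {κ : Kernel β δ}
    {ρ : Measure β} {f : δ → ℝ} (hf : Integrable f (κ ∘ₘ ρ)) :
    ∫ z, f z ∂(κ ∘ₘ ρ) = ∫ y, ∫ z, f z ∂κ y ∂ρ := by
  rw [Measure.comp_eq_comp_const_apply] at hf ⊢
  rw [Kernel.integral_comp hf, Kernel.const_apply]

section RegularProcess

variable {Ω : Type*} [MeasurableSpace Ω] {P : Measure Ω} [IsProbabilityMeasure P]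
  {X : ℝ → Ω → ℝ} {μ : Measure ℝ} {η : ℝ≥0 → Kernel ℝ ℝ} {γ : ℕ → ℕ → ℝ≥0 → ℝ}
  {α : ℕ → ℝ} {h : ℕ → Polynomial ℝ}

lemma past_le (hX : ∀ t, Measurable (X t)) (s : ℝ) : past X s ≤ ‹MeasurableSpace Ω› :=
  iSup₂_le fun r _ => (hX r).comap_le

lemma measurable_past (X : ℝ → Ω → ℝ) {r s : ℝ} (hrs : r ≤ s) : Measurable[past X s] (X r) :=
  measurable_iff_comap_le.2 (le_iSup₂_of_le r hrs le_rfl)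

lemma past_mono (X : ℝ → Ω → ℝ) : Monotone (past X) := fun _ _ hst =>
  iSup₂_le fun r hr => le_iSup₂_of_le r (hr.trans hst) le_rfl

/-! ### The Markov property in terms of laws -/

namespace IsSMPR

lemma isProbabilityMeasure (hX : IsSMPR P X μ η γ) : IsProbabilityMeasure μ := by
  rw [← hX.law 0]
  exact Measure.isProbabilityMeasure_map (hX.measurable 0).aemeasurable

lemma integrable_eval (hX : IsSMPR P X μ η γ) (q : Polynomial ℝ) :
    Integrable (fun x => q.eval x) μ := by
  simp_rw [Polynomial.eval_eq_sum_range]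
  exact integrable_finsetSum _ fun i _ => (hX.moments i).const_mul _

lemma integrable_comp_of_integrable (hX : IsSMPR P X μ η γ) (t : ℝ) {f : ℝ → ℝ}
    (hf : Integrable f μ) : Integrable (fun ω => f (X t ω)) P := by
  rw [← hX.law t] at hf
  exact hf.comp_measurable (hX.measurable t)

lemma ae_of_ae_law (hX : IsSMPR P X μ η γ) (t : ℝ) {p : ℝ → Prop} (hp : ∀ᵐ x ∂μ, p x) :
    ∀ᵐ ω ∂P, p (X t ω) := by
  rw [← hX.law t] at hp
  exact ae_of_ae_map (hX.measurable t).aemeasurable hp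

/-- The Markov property freed from conditional expectations. As an identity of measures for each
past event, it can be summed over disjoint events, transferred to modifications and passed to weak
limits. -/
lemma map_restrict_eq_comp (hX : IsSMPR P X μ η γ) (s : ℝ) {τ : ℝ≥0} (hτ : 0 < τ) {A : Set Ω}
    (hA : MeasurableSet[past X s] A) :
    (P.restrict A).map (X (s + τ)) = η τ ∘ₘ (P.restrict A).map (X s) := by
  have hM := hX.kernel τ hτ
  have hle := past_le hX.measurable s
  ext B hB
  have h1 : MeasurableSet (X (s + τ) ⁻¹' B) := hX.measurable _ hB
  have hreal : Measurable fun y => (η τ y).real B := (η τ).measurable_coe hB |>.ennreal_toReal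
  rw [Measure.map_apply (hX.measurable _) hB, Measure.bind_apply hB (η τ).aemeasurable,
    lintegral_map ((η τ).measurable_coe hB) (hX.measurable s)]
  have h2 : ∫ ω in A, (η τ (X s ω)).real B ∂P = (P.restrict A).real (X (s + τ) ⁻¹' B) := by
    rw [← integral_indicator_one h1]
    change _ = ∫ ω in A, (X (s + τ) ⁻¹' B).indicator (fun _ => (1 : ℝ)) ω ∂P
    rw [← setIntegral_condExp hle ((integrable_const (1 : ℝ)).indicator h1) hA]
    exact setIntegral_congr_ae (hle A hA) ((hX.markov s τ hτ B hB).mono fun ω hω _ => hω.symm)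
  have h3 : ∫⁻ ω in A, η τ (X s ω) B ∂P = ENNReal.ofReal (∫ ω in A, (η τ (X s ω)).real B ∂P) := by
    rw [ofReal_integral_eq_lintegral_ofReal]
    · exact lintegral_congr fun ω => (ofReal_measureReal).symm
    · refine Integrable.of_bound (hreal.comp (hX.measurable s)).aestronglyMeasurable 1
        (Eventually.of_forall fun ω => ?_)
      rw [Real.norm_of_nonneg measureReal_nonneg]
      exact measureReal_le_one
    · exact Eventually.of_forall fun ω => measureReal_nonneg
  rw [h3, h2, ofReal_measureReal]

lemma comp_law (hX : IsSMPR P X μ η γ) {τ : ℝ≥0} (hτ : 0 < τ) : η τ ∘ₘ μ = μ := by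
  have := hX.map_restrict_eq_comp 0 hτ MeasurableSet.univ
  rwa [Measure.restrict_univ, hX.law, hX.law, eq_comm] at this

end IsSMPR

/-! ### The orthonormal polynomials as eigenfunctions -/

namespace IsRSMPR

lemma suppCard_pos (hX : IsRSMPR P X μ η γ α h) : ((0 : ℕ) : ℕ∞) < suppCard μ := by
  have := hX.toIsSMPR.isProbabilityMeasure
  rw [Nat.cast_zero, suppCard, Set.encard_pos]
  exact Measure.nonempty_support (IsProbabilityMeasure.ne_zero μ)

lemma ne_zero (hX : IsRSMPR P X μ η γ α h) {n : ℕ} (hn : (n : ℕ∞) < suppCard μ) : h n ≠ 0 := by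
  rcases Nat.eq_zero_or_pos n with rfl | hpos
  · rw [hX.h_zero]
    exact one_ne_zero
  · intro h0
    have := hX.degree n hn
    rw [h0, Polynomial.natDegree_zero] at this
    omega

lemma lt_of_le {m n : ℕ} (hmn : m ≤ n) (hn : (n : ℕ∞) < suppCard μ) : (m : ℕ∞) < suppCard μ :=
  (Nat.cast_le.2 hmn).trans_lt hn

lemma isUnit_det_coeffMatrix (hX : IsRSMPR P X μ η γ α h) {n : ℕ} (hn : (n : ℕ∞) < suppCard μ) :
    IsUnit (coeffMatrix h n).det := by
  have hlt : ∀ i : Fin (n + 1), ((i : ℕ) : ℕ∞) < suppCard μ := fun i =>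
    lt_of_le (Nat.lt_succ_iff.1 i.2) hn
  rw [Matrix.det_of_isLowerTriangular (coeffMatrix h n), isUnit_iff_ne_zero, Finset.prod_ne_zero_iff]
  · intro i _
    have := hX.degree i (hlt i)
    rw [coeffMatrix, Matrix.of_apply]
    nth_rewrite 2 [← this]
    exact Polynomial.leadingCoeff_ne_zero.2 (hX.ne_zero (hlt i))
  · intro i j hij
    refine Polynomial.coeff_eq_zero_of_natDegree_lt ?_
    rw [hX.degree i (hlt i)]
    exact hij

/-- This is the last row of C A = D C, which follows from A = C⁻¹ D C: the coefficients of `h n`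
form a left eigenvector of the structural matrix. -/
lemma sum_coeff_mul (hX : IsRSMPR P X μ η γ α h) {n : ℕ} (hn : (n : ℕ∞) < suppCard μ)
    {t : ℝ≥0} (ht : 0 < t) {j : ℕ} (hj : j < n + 1) :
    ∑ i ∈ Finset.range (n + 1), (h n).coeff i * (if j ≤ i then γ i j t else 0)
      = Real.exp (-α n * t) * (h n).coeff j := by
  have h1 : coeffMatrix h n * structuralMatrix γ n t
      = Matrix.diagonal (fun i : Fin (n + 1) => Real.exp (-α i * t)) * coeffMatrix h n := by
    rw [hX.diagonalization n hn t ht, ← Matrix.mul_assoc, ← Matrix.mul_assoc,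
      Matrix.mul_nonsing_inv _ (hX.isUnit_det_coeffMatrix hn), Matrix.one_mul]
  have h2 := congrFun (congrFun h1 (Fin.last n)) ⟨j, hj⟩
  rw [Matrix.mul_apply, Matrix.diagonal_mul] at h2
  rw [Finset.sum_range]
  simp only [coeffMatrix, structuralMatrix, Matrix.of_apply, Fin.val_last, Fin.le_def] at h2
  exact h2

lemma condExp_eval (hX : IsRSMPR P X μ η γ α h) {n : ℕ} (hn : (n : ℕ∞) < suppCard μ) (s : ℝ)
    {τ : ℝ≥0} (hτ : 0 < τ) :
    P[fun ω => (h n).eval (X (s + τ) ω) | past X s]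
      =ᵐ[P] fun ω => Real.exp (-α n * τ) * (h n).eval (X s ω) := by
  have heval : ∀ x, (h n).eval x = ∑ i ∈ Finset.range (n + 1), (h n).coeff i * x ^ i := fun x => by
    rw [Polynomial.eval_eq_sum_range, hX.degree n hn]
  have h1 : (fun ω => (h n).eval (X (s + τ) ω))
      = ∑ i ∈ Finset.range (n + 1), (h n).coeff i • fun ω => X (s + τ) ω ^ i := by
    ext ω
    simp [heval]
  have h2 : ∀ i ∈ Finset.range (n + 1), Integrable ((h n).coeff i • fun ω => X (s + τ) ω ^ i) P :=
    fun i _ => (hX.integrable_comp_of_integrable (s + τ) (hX.moments i)).smul _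
  rw [h1]
  refine (condExp_finsetSum h2 _).trans ?_
  have h3 : ∀ᵐ ω ∂P, ∀ i, P[(h n).coeff i • fun ω => X (s + τ) ω ^ i | past X s] ω
      = (h n).coeff i * ∑ j ∈ Finset.range (i + 1), γ i j τ * X s ω ^ j := by
    rw [ae_all_iff]
    intro i
    filter_upwards [condExp_smul ((h n).coeff i) (fun ω => X (s + τ) ω ^ i) (past X s) (μ := P),
      hX.regression i s τ hτ] with ω h4 h5
    rw [h4, Pi.smul_apply, h5, smul_eq_mul]
  filter_upwards [h3] with ω hω
  rw [Finset.sum_apply, heval, Finset.mul_sum]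
  calc ∑ i ∈ Finset.range (n + 1), P[(h n).coeff i • fun ω => X (s + τ) ω ^ i | past X s] ω
      = ∑ i ∈ Finset.range (n + 1), ∑ j ∈ Finset.range (n + 1),
          (h n).coeff i * (if j ≤ i then γ i j τ else 0) * X s ω ^ j := by
        refine Finset.sum_congr rfl fun i hi => ?_
        rw [hω i, Finset.mul_sum]
        -- The triangular sum is padded with zeros to a square one so that the order of summation
        -- can be exchanged.
        refine Finset.sum_subset_zero_on_sdiff
          (Finset.range_mono (Nat.succ_le_of_lt (Finset.mem_range.1 hi))) ?_ ?_
        · intro j hj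
          have : ¬ j ≤ i := by simp at hj; omega
          simp [this]
        · intro j hj
          have : j ≤ i := by simp at hj; omega
          simp [this, mul_assoc]
    _ = ∑ j ∈ Finset.range (n + 1), ∑ i ∈ Finset.range (n + 1),
          (h n).coeff i * (if j ≤ i then γ i j τ else 0) * X s ω ^ j := Finset.sum_comm
    _ = _ := by
        refine Finset.sum_congr rfl fun j hj => ?_
        rw [← Finset.sum_mul, hX.sum_coeff_mul hn hτ (Finset.mem_range.1 hj), mul_assoc]

lemma alpha_zero (hX : IsRSMPR P X μ η γ α h) : α 0 = 0 := by
  have hm := past_le hX.measurable 0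
  have h1 := hX.condExp_eval hX.suppCard_pos 0 one_pos
  simp only [hX.h_zero, Polynomial.eval_one, condExp_const hm, mul_one] at h1
  obtain ⟨ω, hω⟩ := h1.exists
  have := hω.symm
  rw [Real.exp_eq_one_iff] at this
  simpa using this

/-- The eigenfunction relation moves from Ω to the state space by integrating both sides over the
events {X_0 ∈ B}, which lie in the past of time 0. -/
lemma ae_integral_eval (hX : IsRSMPR P X μ η γ α h) {n : ℕ} (hn : (n : ℕ∞) < suppCard μ)
    {τ : ℝ≥0} (hτ : 0 < τ) :
    ∀ᵐ y ∂μ, ∫ z, (h n).eval z ∂η τ y = Real.exp (-α n * τ) * (h n).eval y := by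
  have hM := hX.kernel τ hτ
  have hμ := hX.toIsSMPR.isProbabilityMeasure
  have hsm : StronglyMeasurable fun z => (h n).eval z := (h n).continuous.stronglyMeasurable
  have hint : Integrable (fun z => (h n).eval z) (η τ ∘ₘ μ) := by
    rw [hX.comp_law hτ]
    exact hX.integrable_eval (h n)
  have hle := past_le hX.measurable 0
  have hint_comp : Integrable (fun y => ∫ z, (h n).eval z ∂η τ y) μ := by
    rw [Measure.comp_eq_comp_const_apply] at hint
    simpa using hint.integral_comp
  refine Integrable.ae_eq_of_forall_setIntegral_eq _ _ hint_comp
    ((hX.integrable_eval (h n)).const_mul _) fun B hB _ => ?_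
  have hA : MeasurableSet[past X 0] (X 0 ⁻¹' B) := measurable_past X le_rfl hB
  have hrestr : (P.restrict (X 0 ⁻¹' B)).map (X 0) = μ.restrict B := by
    rw [← Measure.restrict_map (hX.measurable 0) hB, hX.law]
  have hmap := hX.map_restrict_eq_comp 0 hτ hA
  rw [hrestr] at hmap
  have hint' : Integrable (fun z => (h n).eval z) (η τ ∘ₘ μ.restrict B) := by
    rw [← hmap]
    refine (integrable_map_measure hsm.aestronglyMeasurable (hX.measurable _).aemeasurable).2 ?_
    exact (hX.integrable_comp_of_integrable _ (hX.integrable_eval (h n))).integrableOn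
  have h1 : ∫ y in B, ∫ z, (h n).eval z ∂η τ y ∂μ
      = ∫ ω in X 0 ⁻¹' B, (h n).eval (X (0 + τ) ω) ∂P := by
    rw [← integral_comp_measure hint', ← hmap, integral_map (hX.measurable _).aemeasurable
      hsm.aestronglyMeasurable]
  have h2 : ∫ y in B, Real.exp (-α n * τ) * (h n).eval y ∂μ
      = ∫ ω in X 0 ⁻¹' B, Real.exp (-α n * τ) * (h n).eval (X 0 ω) ∂P := by
    rw [← hrestr, integral_map (hX.measurable _).aemeasurable
      (hsm.const_mul _).aestronglyMeasurable]
  rw [h1, h2,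
    ← setIntegral_condExp hle (hX.integrable_comp_of_integrable _ (hX.integrable_eval (h n))) hA]
  exact setIntegral_congr_ae (hle _ hA) ((hX.condExp_eval hn 0 hτ).mono fun ω hω _ => hω)

/-- Induction on the degree d: subtracting a suitable multiple of `h d`, which has exact degree d,
cancels the leading term. -/
lemma toContinuousMapOn_mem_span (hX : IsRSMPR P X μ η γ α h) (q : Polynomial ℝ)
    (hq : (q.natDegree : ℕ∞) < suppCard μ) :
    q.toContinuousMapOn μ.support ∈ Submodule.span ℝ
      (Set.range fun n : {n : ℕ // (n : ℕ∞) < suppCard μ} => (h n).toContinuousMapOn μ.support) := by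
  induction hd : q.natDegree using Nat.strong_induction_on generalizing q with
  | _ d ih =>
    subst hd
    rcases eq_or_ne q 0 with rfl | hq0
    · convert Submodule.zero_mem _
      ext
      simp
    set d := q.natDegree with hd
    have hlead : (h d).leadingCoeff ≠ 0 := Polynomial.leadingCoeff_ne_zero.2 (hX.ne_zero hq)
    set c := q.leadingCoeff / (h d).leadingCoeff with hc
    have hc0 : c ≠ 0 := div_ne_zero (Polynomial.leadingCoeff_ne_zero.2 hq0) hlead
    set r := q - Polynomial.C c * h d with hr
    have hqr : q.toContinuousMapOn μ.support
        = r.toContinuousMapOn μ.support + c • (h d).toContinuousMapOn μ.support := by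
      ext x
      simp [hr]
    have hmem : (h d).toContinuousMapOn μ.support ∈ Submodule.span ℝ
      (Set.range fun n : {n : ℕ // (n : ℕ∞) < suppCard μ} =>
        (h n).toContinuousMapOn μ.support) := Submodule.subset_span ⟨⟨d, hq⟩, rfl⟩
    rw [hqr]
    refine Submodule.add_mem _ ?_ (Submodule.smul_mem _ _ hmem)
    have hdeg : r.degree < q.degree := by
      refine Polynomial.degree_sub_lt_left ?_ hq0 ?_
      · rw [Polynomial.degree_C_mul hc0, Polynomial.degree_eq_natDegree hq0,
          Polynomial.degree_eq_natDegree (hX.ne_zero hq), hX.degree d hq]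
      · rw [Polynomial.leadingCoeff_mul, Polynomial.leadingCoeff_C, hc, div_mul_cancel₀ _ hlead]
    rcases eq_or_ne r 0 with hr0 | hr0
    · rw [hr0]
      convert Submodule.zero_mem _
      ext
      simp
    · have hlt := Polynomial.natDegree_lt_natDegree hr0 hdeg
      exact ih _ hlt r (lt_of_le hlt.le hq) rfl

/-- If the support has ν < ∞ points, the `h n` are available only for n < ν. Reducing modulo the
product of the X - s over the support leaves the function on the support unchanged and brings the
degree below ν. -/
lemma polynomialFunctions_le_span (hX : IsRSMPR P X μ η γ α h) (q : Polynomial ℝ) :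
    q.toContinuousMapOn μ.support ∈ Submodule.span ℝ
      (Set.range fun n : {n : ℕ // (n : ℕ∞) < suppCard μ} => (h n).toContinuousMapOn μ.support) := by
  by_cases hfin : μ.support.Finite
  · set w : Polynomial ℝ := ∏ s ∈ hfin.toFinset, (Polynomial.X - Polynomial.C s) with hw
    have hmonic : w.Monic := Polynomial.monic_prod_X_sub_C _ _
    have hdeg : (w.natDegree : ℕ∞) = suppCard μ := by
      rw [hw, Polynomial.natDegree_finsetProd_X_sub_C_eq_card, suppCard,
        hfin.encard_eq_coe_toFinset_card]
    have hpos : w.natDegree ≠ 0 := by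
      have := hX.suppCard_pos
      rw [← hdeg] at this
      exact (Nat.cast_lt.1 this).ne'
    have heq : q.toContinuousMapOn μ.support = (q %ₘ w).toContinuousMapOn μ.support := by
      ext x
      have hx : w.eval (x : ℝ) = 0 := by
        rw [hw, Polynomial.eval_prod]
        exact Finset.prod_eq_zero (hfin.mem_toFinset.2 x.2) (by simp)
      have := Polynomial.modByMonic_add_div q w
      conv_lhs => rw [← this]
      simp [hx]
    rw [heq]
    refine hX.toContinuousMapOn_mem_span _ ?_
    rw [← hdeg]
    exact Nat.cast_lt.2 (Polynomial.natDegree_modByMonic_lt q hmonic fun h1 => hpos (by simp [h1]))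
  · refine hX.toContinuousMapOn_mem_span q ?_
    rw [suppCard, Set.encard_eq_top hfin]
    exact ENat.natCast_lt_top _

end IsRSMPR

end RegularProcess

/-! ### Restriction of laws and transition probabilities to the support -/

section Support

variable {Ω : Type*} [MeasurableSpace Ω] {P : Measure Ω} [IsProbabilityMeasure P]
  {X : ℝ → Ω → ℝ} {μ : Measure ℝ} {η : ℝ≥0 → Kernel ℝ ℝ} {γ : ℕ → ℕ → ℝ≥0 → ℝ}
  {α : ℕ → ℝ} {h : ℕ → Polynomial ℝ}

/-- The law `μ`, as a measure on its support. -/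
abbrev onSupport (μ : Measure ℝ) : Measure μ.support := μ.comap Subtype.val

lemma measurableSet_support (μ : Measure ℝ) : MeasurableSet μ.support :=
  Measure.isClosed_support.measurableSet

lemma map_onSupport {μ ρ : Measure ℝ} (hρ : ρ μ.supportᶜ = 0) :
    (ρ.comap (Subtype.val : μ.support → ℝ)).map Subtype.val = ρ := by
  rw [(MeasurableEmbedding.subtype_coe (measurableSet_support μ)).map_comap, Subtype.range_coe]
  exact Measure.restrict_eq_self_of_ae_mem hρ

lemma integral_onSupport {μ ρ : Measure ℝ} (hρ : ρ μ.supportᶜ = 0) (f : ℝ → ℝ) :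
    ∫ x : μ.support, f x ∂ρ.comap Subtype.val = ∫ x, f x ∂ρ := by
  rw [integral_subtype_comap (measurableSet_support μ),
    Measure.restrict_eq_self_of_ae_mem (s := μ.support) hρ]

lemma isProbabilityMeasure_onSupport {μ ρ : Measure ℝ} [IsProbabilityMeasure ρ]
    (hρ : ρ μ.supportᶜ = 0) :
    IsProbabilityMeasure (ρ.comap (Subtype.val : μ.support → ℝ)) := by
  refine ⟨?_⟩
  rw [(MeasurableEmbedding.subtype_coe (measurableSet_support μ)).comap_apply, Set.image_univ,
    Subtype.range_coe]
  exact (prob_compl_eq_zero_iff (measurableSet_support μ)).1 hρ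

lemma isOpenPosMeasure_onSupport (μ : Measure ℝ) : (onSupport μ).IsOpenPosMeasure := by
  refine ⟨fun U hU ⟨x, hx⟩ h0 => ?_⟩
  obtain ⟨V, hV, rfl⟩ := isOpen_induced_iff.1 hU
  rw [(MeasurableEmbedding.subtype_coe (measurableSet_support μ)).comap_apply,
    Subtype.image_preimage_coe] at h0
  have h1 : μ V = 0 := by
    refine measure_mono_null (fun y hy => ?_) (measure_union_null h0 μ.measure_compl_support)
    by_cases hyS : y ∈ μ.support
    · exact Or.inl ⟨hyS, hy⟩
    · exact Or.inr hyS
  exact ((μ.mem_support_iff_forall x).1 x.2 V (hV.mem_nhds hx)).ne' h1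

lemma compactSpace_support (hbdd : Bornology.IsBounded μ.support) : CompactSpace μ.support :=
  isCompact_iff_compactSpace.1 (Metric.isCompact_of_isClosed_isBounded Measure.isClosed_support hbdd)

/-- Invariance: the mixture of the transition probabilities under μ is μ itself, which does not
charge the complement of its support. -/
lemma ae_compl_support_eq_zero (hX : IsSMPR P X μ η γ) {τ : ℝ≥0} (hτ : 0 < τ) :
    ∀ᵐ y ∂μ, η τ y μ.supportᶜ = 0 := by
  refine Measure.ae_ae_of_ae_comp (p := fun x => x ∈ μ.support) ?_
  rw [hX.comp_law hτ]
  exact μ.measure_compl_support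

theorem IsRSMPR.isSpectralSystem (hX : IsRSMPR P X μ η γ α h) [CompactSpace μ.support]
    (hsum : ∀ t : ℝ, 0 < t → Summable fun n : {n : ℕ // (n : ℕ∞) < suppCard μ} =>
      Real.exp (-α n * t) * ⨆ x : μ.support, |(h n).eval (x : ℝ)|) :
    IsSpectralSystem (onSupport μ)
      (fun n : {n : ℕ // (n : ℕ∞) < suppCard μ} => (h n).toContinuousMapOn μ.support)
      (fun n => α n) where
  orthogonal i j hij := by
    have := hX.orthonormal i j i.2 j.2
    rw [if_neg fun hc => hij (Subtype.ext hc)] at this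
    exact (integral_onSupport μ.measure_compl_support
      fun x => (h i).eval x * (h j).eval x).trans this
  normalized i := by
    have := hX.orthonormal i i i.2 i.2
    rw [if_pos rfl] at this
    exact (integral_onSupport μ.measure_compl_support
      fun x => (h i).eval x * (h i).eval x).trans this
  summable t ht := by
    simpa [ContinuousMap.norm_eq_iSup_norm] using hsum t ht
  dense := by
    rw [eq_top_iff]
    intro f _
    -- Weierstrass approximation on the compact support.
    have hf : f ∈ (polynomialFunctions μ.support).topologicalClosure := by
      rw [polynomialFunctions.topologicalClosure]
      trivial
    refine closure_mono ?_ hf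
    intro g hg
    obtain ⟨q, rfl⟩ : g ∈ Set.range (Polynomial.toContinuousMapOnAlgHom μ.support) := by
      rw [← polynomialFunctions_coe]
      exact hg
    exact hX.polynomialFunctions_le_span q
  one := ⟨⟨0, hX.suppCard_pos⟩, by ext; simp [hX.h_zero], hX.alpha_zero⟩
  regression t ht := by
    lift t to ℝ≥0 using ht.le
    have ht' : 0 < t := NNReal.coe_pos.1 ht
    have hM := hX.kernel t ht'
    have h1 : ∀ᵐ y ∂μ, ∀ n : {n : ℕ // (n : ℕ∞) < suppCard μ},
        ∫ z, (h n).eval z ∂η t y = Real.exp (-α n * t) * (h n).eval y :=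
      ae_all_iff.2 fun n => hX.ae_integral_eval n.2 ht'
    have h2 : ∀ᵐ y ∂(onSupport μ).map Subtype.val, (∀ n : {n : ℕ // (n : ℕ∞) < suppCard μ},
        ∫ z, (h n).eval z ∂η t y = Real.exp (-α n * t) * (h n).eval y) ∧
          η t y μ.supportᶜ = 0 := by
      rw [map_onSupport μ.measure_compl_support]
      exact h1.and (ae_compl_support_eq_zero hX.toIsSMPR ht')
    filter_upwards [ae_of_ae_map measurable_subtype_coe.aemeasurable h2] with x ⟨hx, hx0⟩
    refine ⟨(η t x).comap Subtype.val, isProbabilityMeasure_onSupport hx0, fun n => ?_⟩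
    exact (integral_onSupport hx0 fun y => (h n).eval y).trans (hx n)

end Support

/-! ### Dyadic numbers and regularization of paths -/

section Regularization

/-- The dyadic rational numbers. -/
def dyadic : Set ℝ := {x | ∃ (n : ℕ) (i : ℤ), x = i / 2 ^ n}

lemma countable_dyadic : dyadic.Countable := by
  have : dyadic = Set.range fun p : ℕ × ℤ => (p.2 / 2 ^ p.1 : ℝ) := by
    ext x
    simp [dyadic, eq_comm]
  rw [this]
  exact Set.countable_range _

/-- The smallest multiple of `2⁻ⁿ` that is larger than `t`. -/
def dyadicAbove (n : ℕ) (t : ℝ) : ℝ := (⌊2 ^ n * t⌋ + 1 : ℤ) / 2 ^ n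

lemma dyadicAbove_mem (n : ℕ) (t : ℝ) : dyadicAbove n t ∈ dyadic := ⟨n, _, rfl⟩

lemma lt_dyadicAbove (n : ℕ) (t : ℝ) : t < dyadicAbove n t := by
  rw [dyadicAbove, lt_div_iff₀ (by positivity), mul_comm]
  push_cast
  exact Int.lt_floor_add_one _

lemma dyadicAbove_le (n : ℕ) (t : ℝ) : dyadicAbove n t ≤ t + (1 / 2) ^ n := by
  rw [dyadicAbove, div_le_iff₀ (by positivity), add_mul, ← mul_pow, mul_comm t]
  push_cast
  norm_num
  exact Int.floor_le _

lemma tendsto_dyadicAbove (t : ℝ) :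
    Tendsto (fun n => dyadicAbove n t) atTop (𝓝[dyadic ∩ Set.Ioi t] t) := by
  refine tendsto_nhdsWithin_iff.2 ⟨?_, Eventually.of_forall fun n =>
    ⟨dyadicAbove_mem n t, lt_dyadicAbove n t⟩⟩
  refine tendsto_of_tendsto_of_tendsto_of_le_of_le tendsto_const_nhds ?_
    (fun n => (lt_dyadicAbove n t).le) (fun n => dyadicAbove_le n t)
  have := tendsto_pow_atTop_nhds_zero_of_lt_one (r := (1 / 2 : ℝ)) (by norm_num) (by norm_num)
  simpa using this.const_add t

instance neBot_dyadic_Ioi (t : ℝ) : (𝓝[dyadic ∩ Set.Ioi t] t).NeBot :=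
  (tendsto_dyadicAbove t).neBot

/-- Closed neighbourhoods of the limit capture the values of g at nearby dyadic points of U, hence
also their right limits G. Openness of U keeps the dyadic points just to the right of s inside U. -/
lemma tendsto_of_tendsto_dyadic {g G : ℝ → ℝ}
    (hG : ∀ s, Tendsto g (𝓝[dyadic ∩ Set.Ioi s] s) (𝓝 (G s))) {U : Set ℝ} (hU : IsOpen U)
    {t l : ℝ} (h : Tendsto g (𝓝[dyadic ∩ U] t) (𝓝 l)) : Tendsto G (𝓝[U] t) (𝓝 l) := by
  refine (closed_nhds_basis l).tendsto_right_iff.2 fun V hV => ?_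
  have h1 := h.eventually_mem hV.1
  obtain ⟨W, hW, hWo, htW⟩ := eventually_nhds_iff.1 (eventually_nhdsWithin_iff.1 h1)
  refine eventually_nhdsWithin_iff.2 (eventually_nhds_iff.2 ⟨W, fun s hs hsU => ?_, hWo, htW⟩)
  refine hV.2.mem_of_tendsto (hG s) ?_
  have h2 : ∀ᶠ q in 𝓝[dyadic ∩ Set.Ioi s] s, q ∈ W ∩ U :=
    mem_nhdsWithin_of_mem_nhds ((hWo.inter hU).mem_nhds ⟨hs, hsU⟩)
  filter_upwards [h2, self_mem_nhdsWithin] with q hq hqD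
  exact hW q hq.1 ⟨hqD.1, hq.2⟩

/-- The function `g` has `k` successive upcrossings from below `a` to above `b` at points of `T`
that lie before `d`. -/
def HasUpcrossings (g : ℝ → ℝ) (T : Set ℝ) (a b : ℝ) : ℕ → ℝ → Prop
  | 0, _ => True
  | k + 1, d => ∃ x ∈ T, ∃ y ∈ T, x < y ∧ y < d ∧ g x < a ∧ b < g y ∧ HasUpcrossings g T a b k x

lemma HasUpcrossings.mono_right {g : ℝ → ℝ} {T : Set ℝ} {a b : ℝ} {k : ℕ} {d d' : ℝ}
    (h : HasUpcrossings g T a b k d) (hd : d ≤ d') : HasUpcrossings g T a b k d' := by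
  cases k with
  | zero => trivial
  | succ k =>
    obtain ⟨x, hx, y, hy, hxy, hyd, h'⟩ := h
    exact ⟨x, hx, y, hy, hxy, hyd.trans_le hd, h'⟩

lemma HasUpcrossings.eventually {g : ℝ → ℝ} {T : Set ℝ} {T' : ℕ → Set ℝ}
    (hT : ∀ x ∈ T, ∀ᶠ n in atTop, x ∈ T' n) {a b : ℝ} {k : ℕ} {d : ℝ}
    (h : HasUpcrossings g T a b k d) : ∀ᶠ n in atTop, HasUpcrossings g (T' n) a b k d := by
  induction k generalizing d with
  | zero => exact Eventually.of_forall fun _ => trivial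
  | succ k ih =>
    obtain ⟨x, hx, y, hy, hxy, hyd, hgx, hgy, h'⟩ := h
    filter_upwards [hT x hx, hT y hy, ih h'] with n hxn hyn hn
    exact ⟨x, hxn, y, hyn, hxy, hyd, hgx, hgy, hn⟩

/-- `HasUpcrossings` peels off the latest upcrossing first, so each new one is simply chosen closer
to t, to the left of those already found. -/
lemma hasUpcrossings_of_frequently_right {g : ℝ → ℝ} {D : Set ℝ} {a b c t : ℝ} (hc : c < t)
    (ha : ∃ᶠ x in 𝓝[D ∩ Set.Ioi t] t, g x < a) (hb : ∃ᶠ x in 𝓝[D ∩ Set.Ioi t] t, b < g x)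
    (k : ℕ) {d : ℝ} (hd : t < d) : HasUpcrossings g (D ∩ Set.Ioi c) a b k d := by
  have hmem : ∀ e, t < e → ∀ᶠ x in 𝓝[D ∩ Set.Ioi t] t, x ∈ D ∩ Set.Ioi t ∧ x < e := fun e he =>
    Eventually.and self_mem_nhdsWithin (mem_nhdsWithin_of_mem_nhds (Iio_mem_nhds he))
  induction k generalizing d with
  | zero => trivial
  | succ k ih =>
    obtain ⟨y, hby, hy, hyd⟩ := (hb.and_eventually (hmem d hd)).exists
    obtain ⟨x, hax, hx, hxy⟩ := (ha.and_eventually (hmem y hy.2)).exists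
    exact ⟨x, ⟨hx.1, hc.trans hx.2⟩, y, ⟨hy.1, hc.trans hy.2⟩, hxy, hyd, hax, hby, ih hx.2⟩

lemma hasUpcrossings_of_frequently_left {g : ℝ → ℝ} {D : Set ℝ} {a b c t : ℝ} (hc : c < t)
    (ha : ∃ᶠ x in 𝓝[D ∩ Set.Iio t] t, g x < a) (hb : ∃ᶠ x in 𝓝[D ∩ Set.Iio t] t, b < g x)
    (k : ℕ) : ∃ d, c < d ∧ d < t ∧ HasUpcrossings g (D ∩ Set.Ioi c) a b k d := by
  have hmem : ∀ e, e < t → ∀ᶠ x in 𝓝[D ∩ Set.Iio t] t, x ∈ D ∩ Set.Iio t ∧ e < x := fun e he =>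
    Eventually.and self_mem_nhdsWithin (mem_nhdsWithin_of_mem_nhds (Ioi_mem_nhds he))
  induction k with
  | zero =>
    obtain ⟨d, hd⟩ := exists_between hc
    exact ⟨d, hd.1, hd.2, trivial⟩
  | succ k ih =>
    obtain ⟨d, hcd, hdt, hd⟩ := ih
    obtain ⟨x, hax, hx, hdx⟩ := (ha.and_eventually (hmem d hdt)).exists
    obtain ⟨y, hby, hy, hxy⟩ := (hb.and_eventually (hmem x hx.2)).exists
    -- On the left of t new upcrossings come later than the old ones, so a bound strictly between
    -- the last point and t is carried along to leave room for the next.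
    obtain ⟨e, hye, het⟩ := exists_between (Set.mem_Iio.1 hy.2)
    refine ⟨e, hcd.trans (hdx.trans (hxy.trans hye)), het, x, ⟨hx.1, hcd.trans hdx⟩, y,
      ⟨hy.1, hcd.trans (hdx.trans hxy)⟩, hxy, hye, hax, hby, hd.mono_right hdx.le⟩

/-- A function which is locally bounded on the dyadic numbers, and has only finitely many
upcrossings on bounded intervals, has one-sided limits along the dyadic numbers. -/
lemma exists_tendsto_dyadic {g : ℝ → ℝ}
    (hbdd : ∀ t, ∃ C, ∀ᶠ x in 𝓝[dyadic] t, |g x| ≤ C)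
    (hup : ∀ (N : ℕ) (a b : ℚ), a < b →
      ∃ k, ¬ HasUpcrossings g (dyadic ∩ Set.Ioi (-N : ℝ)) a b k N) (t : ℝ) :
    (∃ l, Tendsto g (𝓝[dyadic ∩ Set.Ioi t] t) (𝓝 l)) ∧
      ∃ l, Tendsto g (𝓝[dyadic ∩ Set.Iio t] t) (𝓝 l) := by
  obtain ⟨C, hC⟩ := hbdd t
  obtain ⟨N, hN⟩ := exists_nat_gt |t|
  obtain ⟨hN1, hN2⟩ := abs_lt.1 hN
  have hbd : ∀ U : Set ℝ, IsBoundedUnder (· ≤ ·) (𝓝[dyadic ∩ U] t) g ∧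
      IsBoundedUnder (· ≥ ·) (𝓝[dyadic ∩ U] t) g := fun U => by
    have h1 : ∀ᶠ x in 𝓝[dyadic ∩ U] t, |g x| ≤ C := nhdsWithin_mono t Set.inter_subset_left hC
    exact ⟨isBoundedUnder_of_eventually_le (h1.mono fun x hx => (abs_le.1 hx).2),
      isBoundedUnder_of_eventually_ge (h1.mono fun x hx => (abs_le.1 hx).1)⟩
  constructor
  · refine tendsto_of_no_upcrossings Rat.denseRange_cast ?_ (hbd _).1 (hbd _).2
    rintro _ ⟨a, rfl⟩ _ ⟨b, rfl⟩ hab ⟨ha, hb⟩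
    obtain ⟨k, hk⟩ := hup N a b (Rat.cast_lt.1 hab)
    exact hk (hasUpcrossings_of_frequently_right hN1 ha hb k hN2)
  · refine tendsto_of_no_upcrossings Rat.denseRange_cast ?_ (hbd _).1 (hbd _).2
    rintro _ ⟨a, rfl⟩ _ ⟨b, rfl⟩ hab ⟨ha, hb⟩
    obtain ⟨k, hk⟩ := hup N a b (Rat.cast_lt.1 hab)
    obtain ⟨d, _, hdt, hd⟩ := hasUpcrossings_of_frequently_left hN1 ha hb k
    exact hk (hd.mono_right (hdt.trans hN2).le)

end Regularization

/-! ### Upcrossings of martingales along the dyadic numbers -/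

section Martingale

/-- The points of the grid of mesh `2⁻ⁿ` starting from `-N`. -/
def gridPoint (N n i : ℕ) : ℝ := -N + i / 2 ^ n

lemma gridPoint_strictMono (N n : ℕ) : StrictMono (gridPoint N n) := fun i j hij => by
  have : (i : ℝ) < j := Nat.cast_lt.2 hij
  rw [gridPoint, gridPoint]
  gcongr

lemma gridPoint_last (N n : ℕ) : gridPoint N n (2 * N * 2 ^ n) = N := by
  rw [gridPoint]
  push_cast
  field_simp
  ring

lemma eventually_mem_range_gridPoint (N : ℕ) :
    ∀ x ∈ dyadic ∩ Set.Ioi (-N : ℝ), ∀ᶠ n in atTop, x ∈ Set.range (gridPoint N n) := by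
  rintro x ⟨⟨m, i, rfl⟩, hx⟩
  filter_upwards [eventually_ge_atTop m] with n hn
  obtain ⟨r, rfl⟩ := Nat.exists_eq_add_of_le hn
  have hx' : 0 < (i + N * 2 ^ m : ℤ) := by
    have h1 : (-N : ℝ) * 2 ^ m < i := (lt_div_iff₀ (by positivity)).1 hx
    have h2 : (0 : ℝ) < ((i + N * 2 ^ m : ℤ) : ℝ) := by
      push_cast
      linarith
    exact_mod_cast h2
  obtain ⟨j, hj⟩ := Int.eq_ofNat_of_zero_le hx'.le
  refine ⟨j * 2 ^ r, ?_⟩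
  have hj' : (i : ℝ) + N * 2 ^ m = j := by exact_mod_cast hj
  rw [gridPoint, pow_add]
  push_cast
  rw [← hj']
  field_simp
  ring

variable {Ω : Type*} {mΩ : MeasurableSpace Ω} {P : Measure Ω}

lemma le_upcrossingsBefore_of_hasUpcrossings {M : ℝ → Ω → ℝ} {N n : ℕ} {a b : ℝ} (hab : a < b)
    {ω : Ω} {k : ℕ} {d : ℝ}
    (h : HasUpcrossings (fun t => M t ω) (Set.range (gridPoint N n)) a b k d) {j : ℕ}
    (hj : d ≤ gridPoint N n j) :
    k ≤ upcrossingsBefore a b (fun i => M (gridPoint N n i)) j ω := by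
  induction k generalizing d j with
  | zero => exact Nat.zero_le _
  | succ k ih =>
    obtain ⟨_, ⟨i₁, rfl⟩, _, ⟨i₂, rfl⟩, hlt, hyd, ha, hb, h'⟩ := h
    have h12 := (gridPoint_strictMono N n).lt_iff_lt.1 hlt
    have h2j := (gridPoint_strictMono N n).lt_iff_lt.1 (hyd.trans_le hj)
    -- A crossing completed at index `i₂` is counted from index `i₂ + 1` on, which is at most `j`.
    have h3 := upcrossingsBefore_lt_of_exists_upcrossing (N := i₁)
      (f := fun i => M (gridPoint N n i)) hab le_rfl ha h12.le hb
    exact (Nat.succ_le_of_lt ((ih h' le_rfl).trans_lt h3)).trans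
      (upcrossingsBefore_mono hab (Nat.succ_le_of_lt h2j) ω)

/-- Doob's inequality bounds the expected number of upcrossings on every dyadic grid of [-N, N] by a
constant independent of the mesh. Fatou's lemma makes the lower limit over the grids finite almost
surely, while each finite chain of upcrossings lies in all fine grids. -/
lemma ae_exists_not_hasUpcrossings [IsFiniteMeasure P] {M : ℝ → Ω → ℝ} {𝓕 : Filtration ℝ mΩ}
    (hM : Martingale M 𝓕 P) (N : ℕ) {a b : ℝ} (hab : a < b) :
    ∀ᵐ ω ∂P, ∃ k, ¬ HasUpcrossings (fun t => M t ω) (dyadic ∩ Set.Ioi (-N : ℝ)) a b k N := by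
  let 𝓖 : ℕ → Filtration ℕ mΩ := fun n =>
    ⟨fun i => 𝓕 (gridPoint N n i), fun i j hij => 𝓕.mono ((gridPoint_strictMono N n).monotone hij),
      fun i => 𝓕.le _⟩
  have hsub : ∀ n, Submartingale (fun i => M (gridPoint N n i)) (𝓖 n) P := fun n =>
    Martingale.submartingale ⟨fun i => hM.1 _, fun i j hij =>
      hM.2 _ _ ((gridPoint_strictMono N n).monotone hij)⟩
  let U : ℕ → Ω → ℕ := fun n =>
    upcrossingsBefore a b (fun i => M (gridPoint N n i)) (2 * N * 2 ^ n)
  set C : ℝ := (∫ ω, (M N ω - a)⁺ ∂P) / (b - a) with hC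
  have hU : ∀ n, ∫ ω, (U n ω : ℝ) ∂P ≤ C := fun n => by
    have := (hsub n).mul_integral_upcrossingsBefore_le_integral_pos_part a b (2 * N * 2 ^ n)
    rw [gridPoint_last] at this
    rw [hC, le_div_iff₀ (sub_pos.2 hab), mul_comm]
    exact this
  have hUm : ∀ n, Measurable (U n) := fun n =>
    (hsub n).stronglyAdapted.measurable_upcrossingsBefore hab
  have hUl : ∀ n, ∫⁻ ω, (U n ω : ℝ≥0∞) ∂P ≤ ENNReal.ofReal C := fun n => by
    have hint := (hsub n).stronglyAdapted.integrable_upcrossingsBefore (μ := P)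
      (N := 2 * N * 2 ^ n) hab
    have h1 := ofReal_integral_eq_lintegral_ofReal hint
      (Eventually.of_forall fun ω => Nat.cast_nonneg _)
    simp_rw [ENNReal.ofReal_natCast] at h1
    exact h1.symm.trans_le (ENNReal.ofReal_le_ofReal (hU n))
  have hfin : ∫⁻ ω, liminf (fun n => (U n ω : ℝ≥0∞)) atTop ∂P ≠ ⊤ := by
    refine ne_top_of_le_ne_top ENNReal.ofReal_ne_top
      ((lintegral_liminf_le fun n => measurable_from_top.comp (hUm n)).trans
        (liminf_le_of_le ⟨0, by simp⟩ fun c hc => ?_) : _ ≤ ENNReal.ofReal C)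
    obtain ⟨n, hn⟩ := hc.exists
    exact hn.trans (hUl n)
  have hmeas : Measurable fun ω => liminf (fun n => (U n ω : ℝ≥0∞)) atTop :=
    Measurable.liminf fun n => measurable_from_top.comp (hUm n)
  filter_upwards [ae_lt_top hmeas hfin] with ω hω
  by_contra! hcon
  refine hω.ne (ENNReal.eq_top_of_forall_nnreal_le fun r => ?_)
  obtain ⟨k, hk⟩ := exists_nat_gt r
  refine le_liminf_of_le (by isBoundedDefault) ?_
  filter_upwards [(hcon k).eventually (eventually_mem_range_gridPoint N)] with n hn
  have := le_upcrossingsBefore_of_hasUpcrossings hab hn (gridPoint_last N n).ge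
  calc (r : ℝ≥0∞) ≤ ((k : ℝ≥0) : ℝ≥0∞) := ENNReal.coe_le_coe.2 hk.le
    _ = (k : ℝ≥0∞) := by simp
    _ ≤ U n ω := Nat.cast_le.2 this

/-- A martingale whose paths are locally bounded on the dyadic numbers almost surely has one-sided
limits along the dyadic numbers. -/
theorem ae_exists_tendsto_dyadic [IsFiniteMeasure P] {M : ℝ → Ω → ℝ} {𝓕 : Filtration ℝ mΩ}
    (hM : Martingale M 𝓕 P)
    (hbdd : ∀ᵐ ω ∂P, ∀ t, ∃ C, ∀ᶠ x in 𝓝[dyadic] t, |M x ω| ≤ C) :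
    ∀ᵐ ω ∂P, ∀ t, (∃ l, Tendsto (fun r => M r ω) (𝓝[dyadic ∩ Set.Ioi t] t) (𝓝 l)) ∧
      ∃ l, Tendsto (fun r => M r ω) (𝓝[dyadic ∩ Set.Iio t] t) (𝓝 l) := by
  have h1 : ∀ᵐ ω ∂P, ∀ (N : ℕ) (a b : ℚ), a < b →
      ∃ k, ¬ HasUpcrossings (fun t => M t ω) (dyadic ∩ Set.Ioi (-N : ℝ)) a b k N := by
    simp only [ae_all_iff]
    exact fun N a b hab => ae_exists_not_hasUpcrossings hM N (Rat.cast_lt.2 hab)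
  filter_upwards [h1, hbdd] with ω hω hb
  exact exists_tendsto_dyadic hb hω

end Martingale

/-! ### The modification with right-continuous paths and left limits -/

section Modification

variable {Ω : Type*} [mΩ : MeasurableSpace Ω] {P : Measure Ω} [IsProbabilityMeasure P]
  {X : ℝ → Ω → ℝ} {μ : Measure ℝ} {η : ℝ≥0 → Kernel ℝ ℝ} {γ : ℕ → ℕ → ℝ≥0 → ℝ}
  {α : ℕ → ℝ} {h : ℕ → Polynomial ℝ}

/-- The filtration generated by the process. -/
def pastFiltration (hX : ∀ t, Measurable (X t)) : Filtration ℝ mΩ :=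
  ⟨past X, past_mono X, past_le hX⟩

lemma IsSMPR.ae_mem_support (hX : IsSMPR P X μ η γ) (t : ℝ) : ∀ᵐ ω ∂P, X t ω ∈ μ.support :=
  hX.ae_of_ae_law t μ.support_mem_ae

lemma IsRSMPR.martingale (hX : IsRSMPR P X μ η γ α h) {n : ℕ} (hn : (n : ℕ∞) < suppCard μ) :
    Martingale (fun t ω => Real.exp (α n * t) * (h n).eval (X t ω))
      (pastFiltration hX.measurable) P := by
  have hint : ∀ t, Integrable (fun ω => (h n).eval (X t ω)) P := fun t =>
    hX.integrable_comp_of_integrable t (hX.integrable_eval (h n))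
  have hmeas : ∀ s, StronglyMeasurable[past X s]
      fun ω => Real.exp (α n * s) * (h n).eval (X s ω) := fun s => by
    refine Measurable.stronglyMeasurable ?_
    exact ((h n).continuous.measurable.comp (measurable_past X le_rfl)).const_mul _
  refine ⟨hmeas, fun s t hst => ?_⟩
  rcases hst.eq_or_lt with rfl | hlt
  · rw [condExp_of_stronglyMeasurable ((pastFiltration hX.measurable).le s) (hmeas s)
      ((hint s).const_mul _)]
  obtain ⟨τ, rfl⟩ : ∃ τ : ℝ≥0, t = s + τ :=
    ⟨(t - s).toNNReal, by rw [Real.coe_toNNReal _ (sub_nonneg.2 hst), add_sub_cancel]⟩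
  have hτ : 0 < τ := by
    rw [← NNReal.coe_pos]
    linarith
  have h1 := condExp_smul (μ := P) (Real.exp (α n * (s + τ)))
    (fun ω => (h n).eval (X (s + τ) ω)) (past X s)
  change P[Real.exp (α n * (s + τ)) • fun ω => (h n).eval (X (s + τ) ω) | past X s] =ᵐ[P] _
  filter_upwards [h1, hX.condExp_eval hn s hτ] with ω h2 h3
  rw [h2, Pi.smul_apply, h3, smul_eq_mul, ← mul_assoc, ← Real.exp_add]
  ring_nf

/-- Since `h 1` is affine with non-zero slope, X is recovered continuously from the martingale
e^{α_1 t} h_1(X_t), whose paths are locally bounded because the support is. -/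
lemma IsRSMPR.ae_exists_tendsto (hX : IsRSMPR P X μ η γ α h)
    (hbdd : Bornology.IsBounded μ.support) (hcard : ((1 : ℕ) : ℕ∞) < suppCard μ) :
    ∀ᵐ ω ∂P, ∀ t, (∃ l, Tendsto (fun r => X r ω) (𝓝[dyadic ∩ Set.Ioi t] t) (𝓝 l)) ∧
      ∃ l, Tendsto (fun r => X r ω) (𝓝[dyadic ∩ Set.Iio t] t) (𝓝 l) := by
  obtain ⟨R, hR⟩ := hbdd.exists_norm_le
  have hdeg := hX.degree 1 hcard
  set c := (h 1).coeff 1 with hc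
  set d := (h 1).coeff 0 with hd
  have heval : ∀ x, (h 1).eval x = c * x + d := fun x => by
    rw [Polynomial.eq_X_add_C_of_natDegree_le_one hdeg.le]
    simp [← hc, ← hd]
  have hc0 : c ≠ 0 := by
    have := Polynomial.leadingCoeff_ne_zero.2 (hX.ne_zero hcard)
    rwa [Polynomial.leadingCoeff, hdeg] at this
  have hdy : ∀ᵐ ω ∂P, ∀ q ∈ dyadic, X q ω ∈ μ.support :=
    (ae_ball_iff countable_dyadic).2 fun q _ => hX.ae_mem_support q
  have hM := ae_exists_tendsto_dyadic (hX.martingale hcard) (by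
    filter_upwards [hdy] with ω hω t
    refine ⟨(Real.exp (α 1 * t) + 1) * (|c| * R + |d|), ?_⟩
    have hcont : Continuous fun x : ℝ => Real.exp (α 1 * x) := by fun_prop
    have h1 : ∀ᶠ x in 𝓝[dyadic] t, Real.exp (α 1 * x) < Real.exp (α 1 * t) + 1 :=
      mem_nhdsWithin_of_mem_nhds (hcont.tendsto t (Iio_mem_nhds (lt_add_one _)))
    filter_upwards [h1, self_mem_nhdsWithin] with x hx hxD
    have h2 : |(h 1).eval (X x ω)| ≤ |c| * R + |d| := by
      rw [heval]
      refine (abs_add_le _ _).trans ?_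
      rw [abs_mul]
      gcongr
      exact hR _ (hω x hxD)
    rw [abs_mul, Real.abs_exp]
    exact mul_le_mul hx.le h2 (abs_nonneg _) (by positivity))
  filter_upwards [hM] with ω hω t
  have key : ∀ r, X r ω
      = (Real.exp (-(α 1 * r)) * (Real.exp (α 1 * r) * (h 1).eval (X r ω)) - d) / c := fun r => by
    rw [← mul_assoc, ← Real.exp_add, heval]
    field_simp
    simp
  have hexp : ∀ U : Set ℝ,
      Tendsto (fun r => Real.exp (-(α 1 * r))) (𝓝[U] t) (𝓝 (Real.exp (-(α 1 * t)))) := fun U => by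
    have hcont : Continuous fun x : ℝ => Real.exp (-(α 1 * x)) := by fun_prop
    exact (hcont.tendsto t).mono_left nhdsWithin_le_nhds
  obtain ⟨⟨l, hl⟩, ⟨l', hl'⟩⟩ := hω t
  refine ⟨⟨(Real.exp (-(α 1 * t)) * l - d) / c, ?_⟩,
    ⟨(Real.exp (-(α 1 * t)) * l' - d) / c, ?_⟩⟩
  · exact ((((hexp _).mul hl).sub_const d).div_const c).congr fun r => (key r).symm
  · exact ((((hexp _).mul hl').sub_const d).div_const c).congr fun r => (key r).symm

/-- Mean-square continuity. -/
lemma IsSMPR.tendsto_integral_sub_sq (hX : IsSMPR P X μ η γ) (s : ℝ) :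
    Tendsto (fun t => ∫ ω, (X t ω - X s ω) ^ 2 ∂P) (𝓝 s) (𝓝 0) := by
  have hsq : ∀ t, Integrable (fun ω => X t ω ^ 2) P := fun t =>
    hX.integrable_comp_of_integrable t (hX.moments 2)
  have hmem : ∀ t, MemLp (X t) 2 P := fun t =>
    (memLp_two_iff_integrable_sq (hX.measurable t).aestronglyMeasurable).2 (hsq t)
  have hmul : ∀ t, Integrable (fun ω => X t ω * X s ω) P := fun t =>
    (hmem t).integrable_mul (hmem s)
  have hexp : ∀ t, ∫ ω, (X t ω - X s ω) ^ 2 ∂P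
      = ∫ ω, X t ω ^ 2 ∂P - 2 * ∫ ω, X t ω * X s ω ∂P + ∫ ω, X s ω ^ 2 ∂P := fun t => by
    have h1 := integral_sub (hsq t) ((hmul t).const_mul 2)
    have h2 := integral_add ((hsq t).sub ((hmul t).const_mul 2)) (hsq s)
    rw [integral_const_mul] at h1
    rw [← h1]
    refine Eq.trans ?_ h2
    congr 1
    ext ω
    simp only [Pi.sub_apply]
    ring
  have h2 : ∀ t, ∫ ω, X t ω ^ 2 ∂P = ∫ ω, X s ω ^ 2 ∂P := fun t => by
    have : ∀ u, ∫ ω, X u ω ^ 2 ∂P = ∫ x, x ^ 2 ∂μ := fun u => by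
      rw [← hX.law u, integral_map (hX.measurable u).aemeasurable (by fun_prop)]
    rw [this, this]
  have hlim := hX.msc 1 1 s
  simp only [pow_one] at hlim
  have := ((tendsto_const_nhds (x := ∫ ω, X s ω ^ 2 ∂P)).sub (hlim.const_mul 2)).add_const
    (∫ ω, X s ω ^ 2 ∂P)
  simp_rw [hexp, h2]
  convert this using 2
  ring

lemma IsRSMPR.exists_modification_of_one_lt (hX : IsRSMPR P X μ η γ α h)
    (hbdd : Bornology.IsBounded μ.support) (hcard : ((1 : ℕ) : ℕ∞) < suppCard μ) :
    ∃ Y : ℝ → Ω → ℝ, (∀ t, Measurable (Y t)) ∧ IsModification P Y X ∧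
      RightContinuousPaths Y ∧ LeftLimitPaths Y ∧ ∀ t ω, Y t ω ∈ μ.support := by
  classical
  have hμ := hX.toIsSMPR.isProbabilityMeasure
  obtain ⟨R, hR⟩ := hbdd.exists_norm_le
  obtain ⟨s₀, hs₀⟩ := Measure.nonempty_support (IsProbabilityMeasure.ne_zero μ)
  have hdy : ∀ᵐ ω ∂P, ∀ q ∈ dyadic, X q ω ∈ μ.support :=
    (ae_ball_iff countable_dyadic).2 fun q _ => hX.ae_mem_support q
  obtain ⟨A, hA, hAm, hAP⟩ :=
    (hdy.and (hX.ae_exists_tendsto hbdd hcard)).exists_measurable_mem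
  -- On the exceptional null set the path is replaced by a constant in the support, so that limits
  -- exist for every ω.
  let Z : ℝ → Ω → ℝ := fun t ω => if ω ∈ A then X t ω else s₀
  have hZm : ∀ t, Measurable (Z t) := fun t => (hX.measurable t).ite hAm measurable_const
  have hZS : ∀ ω, ∀ q ∈ dyadic, Z q ω ∈ μ.support := fun ω q hq => by
    by_cases hω : ω ∈ A
    · simpa [Z, hω] using (hAP ω hω).1 q hq
    · simpa [Z, hω] using hs₀
  have hZlim : ∀ ω t, (∃ l, Tendsto (fun r => Z r ω) (𝓝[dyadic ∩ Set.Ioi t] t) (𝓝 l)) ∧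
      ∃ l, Tendsto (fun r => Z r ω) (𝓝[dyadic ∩ Set.Iio t] t) (𝓝 l) := fun ω t => by
    by_cases hω : ω ∈ A
    · simpa [Z, hω] using (hAP ω hω).2 t
    · simp only [Z, hω, if_false]
      exact ⟨⟨s₀, tendsto_const_nhds⟩, ⟨s₀, tendsto_const_nhds⟩⟩
  choose Y hY using fun t ω => (hZlim ω t).1
  have hYseq : ∀ t ω, Tendsto (fun n => Z (dyadicAbove n t) ω) atTop (𝓝 (Y t ω)) := fun t ω =>
    (hY t ω).comp (tendsto_dyadicAbove t)
  have hYm : ∀ t, Measurable (Y t) := fun t =>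
    measurable_of_tendsto_metrizable (fun n => hZm (dyadicAbove n t))
      (tendsto_pi_nhds.2 (hYseq t))
  have hYS : ∀ t ω, Y t ω ∈ μ.support := fun t ω =>
    Measure.isClosed_support.mem_of_tendsto (hYseq t ω)
      (Eventually.of_forall fun n => hZS ω _ (dyadicAbove_mem n t))
  refine ⟨Y, hYm, fun t => ?_, fun ω t => ?_, fun ω t => ?_, hYS⟩
  · have hZX : ∀ s, Z s =ᵐ[P] X s := fun s => by
      filter_upwards [hA] with ω hω
      simp [Z, hω]
    -- The same integrals tend to 0 by mean-square continuity and to ∫ (Y_t - X_t)² dP by dominated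
    -- convergence.
    have h1 : Tendsto (fun n => ∫ ω, (Z (dyadicAbove n t) ω - X t ω) ^ 2 ∂P) atTop (𝓝 0) := by
      have h2 := (hX.tendsto_integral_sub_sq t).comp
        ((tendsto_nhdsWithin_iff.1 (tendsto_dyadicAbove t)).1)
      refine h2.congr fun n => integral_congr_ae ?_
      filter_upwards [hZX (dyadicAbove n t)] with ω hω
      rw [hω]
    have h3 : Tendsto (fun n => ∫ ω, (Z (dyadicAbove n t) ω - X t ω) ^ 2 ∂P) atTop
        (𝓝 (∫ ω, (Y t ω - X t ω) ^ 2 ∂P)) := by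
      refine tendsto_integral_of_dominated_convergence (fun _ => (R + R) ^ 2)
        (fun n => (((hZm _).sub (hX.measurable t)).pow_const 2).aestronglyMeasurable)
        (integrable_const _) (fun n => ?_) (Eventually.of_forall fun ω => ?_)
      · filter_upwards [hX.ae_mem_support t] with ω hω
        rw [norm_pow]
        gcongr
        exact (norm_sub_le _ _).trans
          (add_le_add (hR _ (hZS ω _ (dyadicAbove_mem n t))) (hR _ hω))
      · exact ((hYseq t ω).sub_const _).pow 2
    have h4 : ∫ ω, (Y t ω - X t ω) ^ 2 ∂P = 0 := tendsto_nhds_unique h3 h1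
    have h5 : Integrable (fun ω => (Y t ω - X t ω) ^ 2) P := by
      refine Integrable.of_bound
        (((hYm t).sub (hX.measurable t)).pow_const 2).aestronglyMeasurable ((R + R) ^ 2) ?_
      filter_upwards [hX.ae_mem_support t] with ω hω
      rw [norm_pow]
      gcongr
      exact (norm_sub_le _ _).trans (add_le_add (hR _ (hYS t ω)) (hR _ hω))
    filter_upwards [(integral_eq_zero_iff_of_nonneg (fun ω => sq_nonneg _) h5).1 h4] with ω hω
    exact sub_eq_zero.1 (pow_eq_zero_iff two_ne_zero |>.1 hω)
  · exact continuousWithinAt_Ioi_iff_Ici.1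
      (tendsto_of_tendsto_dyadic (fun s => hY s ω) isOpen_Ioi (hY t ω))
  · obtain ⟨l, hl⟩ := (hZlim ω t).2
    exact ⟨l, tendsto_of_tendsto_dyadic (fun s => hY s ω) isOpen_Iio hl⟩

theorem IsRSMPR.exists_modification (hX : IsRSMPR P X μ η γ α h)
    (hbdd : Bornology.IsBounded μ.support) :
    ∃ Y : ℝ → Ω → ℝ, (∀ t, Measurable (Y t)) ∧ IsModification P Y X ∧
      RightContinuousPaths Y ∧ LeftLimitPaths Y ∧ ∀ t ω, Y t ω ∈ μ.support := by
  rcases lt_or_ge ((1 : ℕ) : ℕ∞) (suppCard μ) with hcard | hcard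
  · exact hX.exists_modification_of_one_lt hbdd hcard
  -- With a one-point support `h 1` is not available, but a constant process serves.
  have hμ := hX.toIsSMPR.isProbabilityMeasure
  obtain ⟨s₀, hs₀⟩ := Measure.nonempty_support (IsProbabilityMeasure.ne_zero μ)
  have hsub : ∀ x ∈ μ.support, x = s₀ := fun x hx =>
    Set.encard_le_one_iff.1 (by simpa [suppCard] using hcard) x s₀ hx hs₀
  refine ⟨fun _ _ => s₀, fun _ => measurable_const, fun t => ?_, fun ω t => ?_, fun ω t => ?_,
    fun _ _ => hs₀⟩
  · filter_upwards [hX.ae_mem_support t] with ω hω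
    exact (hsub _ hω).symm
  · exact continuousWithinAt_const
  · exact ⟨s₀, tendsto_const_nhds⟩

end Modification

/-! ### The strong Markov property of right-continuous Feller processes -/

section StrongMarkov

/-- The transition kernel `onReal κ`. -/
def onRealKernel {S : Set ℝ} (hS : MeasurableSet S) (κ : Kernel S S) : Kernel ℝ ℝ where
  toFun := onReal κ
  measurable' := by
    classical
    have h1 : Measurable fun x : S => (κ x).map Subtype.val :=
      (Measure.measurable_map _ measurable_subtype_coe).comp κ.measurable
    have h2 : Measurable fun x : (Sᶜ : Set ℝ) => Measure.dirac (x : ℝ) :=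
      Measure.measurable_dirac.comp measurable_subtype_coe
    have h3 := Measurable.dite h1 h2 hS
    have h4 : onReal κ = fun y : ℝ => if hy : y ∈ S then (κ ⟨y, hy⟩).map Subtype.val
        else Measure.dirac y := by
      ext1 y
      by_cases hy : y ∈ S <;> simp [onReal, hy]
    rw [h4]
    exact h3

lemma onRealKernel_apply {S : Set ℝ} (hS : MeasurableSet S) (κ : Kernel S S) (y : ℝ) :
    onRealKernel hS κ y = onReal κ y := rfl

lemma onReal_of_mem {S : Set ℝ} (κ : Kernel S S) {y : ℝ} (hy : y ∈ S) :
    onReal κ y = (κ ⟨y, hy⟩).map Subtype.val := dif_pos hy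

lemma onReal_id {S : Set ℝ} (y : ℝ) : onReal (Kernel.id : Kernel S S) y = Measure.dirac y := by
  by_cases hy : y ∈ S
  · rw [onReal_of_mem _ hy, Kernel.id_apply, Measure.map_dirac' measurable_subtype_coe]
  · exact dif_neg hy

instance isMarkovKernel_onRealKernel {S : Set ℝ} (hS : MeasurableSet S) (κ : Kernel S S)
    [IsMarkovKernel κ] : IsMarkovKernel (onRealKernel hS κ) := by
  refine ⟨fun y => ?_⟩
  rw [onRealKernel_apply]
  by_cases hy : y ∈ S
  · rw [onReal_of_mem κ hy]
    exact Measure.isProbabilityMeasure_map measurable_subtype_coe.aemeasurable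
  · rw [onReal, dif_neg hy]
    infer_instance

lemma onRealKernel_id_comp {S : Set ℝ} (hS : MeasurableSet S) (ρ : Measure ℝ) :
    onRealKernel hS (Kernel.id : Kernel S S) ∘ₘ ρ = ρ := by
  have : onRealKernel hS (Kernel.id : Kernel S S) = Kernel.id := by
    ext1 y
    rw [onRealKernel_apply, onReal_id, Kernel.id_apply]
  rw [this, Measure.id_comp]

lemma tendsto_dyadicAbove_Ici (t : ℝ) :
    Tendsto (fun n => dyadicAbove n t) atTop (𝓝[Set.Ici t] t) :=
  (tendsto_dyadicAbove t).mono_right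
    (nhdsWithin_mono t (Set.inter_subset_right.trans Set.Ioi_subset_Ici_self))

/-- Joint measurability of a right-continuous process. -/
lemma measurable_eval_of_rightContinuous {Ω T : Type*} [MeasurableSpace T] [MeasurableSpace Ω]
    {Z : ℝ → Ω → ℝ} (hZ : ∀ r, Measurable (Z r)) {s : T → ℝ} (hs : Measurable s)
    (hrc : ∀ ω t, ContinuousWithinAt (fun r => Z r ω) (Set.Ici t) t) :
    Measurable fun p : T × Ω => Z (s p.1) p.2 := by
  refine measurable_of_tendsto_metrizable
    (f := fun n (p : T × Ω) => Z (dyadicAbove n (s p.1)) p.2) (fun n => ?_)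
    (tendsto_pi_nhds.2 fun p => (hrc p.2 (s p.1)).tendsto.comp (tendsto_dyadicAbove_Ici _))
  have h1 : Measurable fun q : Ω × ℤ => Z (((q.2 + 1 : ℤ) : ℝ) / 2 ^ n) q.1 :=
    measurable_from_prod_countable_left fun i =>
      hZ (((i + 1 : ℤ) : ℝ) / 2 ^ n)
  have h2 : Measurable fun p : T × Ω => (p.2, ⌊2 ^ n * s p.1⌋) :=
    measurable_snd.prodMk (Int.measurable_floor.comp ((hs.comp measurable_fst).const_mul _))
  exact h1.comp h2

variable {Ω : Type*} {mΩ : MeasurableSpace Ω} {P : Measure Ω} {Y : ℝ → Ω → ℝ}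

lemma naturalPlus_apply (hY : ∀ t, Measurable (Y t)) (t : ℝ) :
    naturalPlus Y hY t = ⨅ u > t, past Y u := by
  rw [naturalPlus, Filtration.rightCont_eq]
  rfl

lemma past_le_naturalPlus (hY : ∀ t, Measurable (Y t)) (t : ℝ) : past Y t ≤ naturalPlus Y hY t := by
  rw [naturalPlus_apply]
  exact le_iInf₂ fun u hu => past_mono Y (le_of_lt hu)

lemma naturalPlus_le_past (hY : ∀ t, Measurable (Y t)) {t u : ℝ} (htu : t < u) :
    naturalPlus Y hY t ≤ past Y u := by
  rw [naturalPlus_apply]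
  exact iInf₂_le u htu

lemma isStronglyProgressive (hY : ∀ t, Measurable (Y t)) (hrc : RightContinuousPaths Y) :
    IsStronglyProgressive (naturalPlus Y hY) Y := by
  intro i
  let := naturalPlus Y hY i
  -- Freezing the process at time i makes all its variables measurable for the past of i without
  -- changing it on (-∞, i].
  have h1 := measurable_eval_of_rightContinuous (T := Set.Iic i)
    (Z := fun r => Y (min r i)) (s := Subtype.val)
    (fun r => (measurable_past Y (min_le_right r i)).mono (past_le_naturalPlus hY i) le_rfl)
    measurable_subtype_coe fun ω t => by
      refine (hrc ω (min t i)).comp (f := fun r => min r i) (by fun_prop) fun r hr => ?_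
      exact min_le_min_right i hr
  refine (Measurable.stronglyMeasurable ?_)
  refine (congrArg Measurable (funext fun p => ?_)).mp h1
  rw [min_eq_left p.1.2]

/-- The strict inequality absorbs the right limit in the filtration: {τ < q} is the union of the
events {τ ≤ r} for certain r < q, and F_{r+} is contained in the past of q. Thus the simple Markov
property at q applies. -/
lemma measurableSet_inter_lt (hY : ∀ t, Measurable (Y t)) {τ : Ω → WithTop ℝ}
    (hτ : IsStoppingTime (naturalPlus Y hY) τ) {A : Set Ω}
    (hA : MeasurableSet[hτ.measurableSpace] A) (q : ℝ) :
    MeasurableSet[past Y q] (A ∩ {ω | τ ω < q}) := by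
  have heq : A ∩ {ω | τ ω < q}
      = ⋃ k : ℕ, A ∩ {ω | τ ω ≤ ((q - 1 / (k + 1) : ℝ) : WithTop ℝ)} := by
    ext ω
    simp only [Set.mem_inter_iff, Set.mem_ofPred_eq, Set.mem_iUnion, exists_and_left,
      and_congr_right_iff]
    intro _
    cases hω : τ ω with
    | top => simp
    | coe s =>
      simp only [WithTop.coe_lt_coe, WithTop.coe_le_coe]
      constructor
      · intro hs
        obtain ⟨k, hk⟩ := exists_nat_one_div_lt (sub_pos.2 hs)
        exact ⟨k, by linarith⟩
      · rintro ⟨k, hk⟩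
        have : (0 : ℝ) < 1 / (k + 1) := by positivity
        linarith
  rw [heq]
  refine MeasurableSet.iUnion fun k => ?_
  exact naturalPlus_le_past hY (sub_lt_self q (by positivity)) _ (hA.2 _)

/-- The event that the stopping time lies in the `i`-th dyadic interval of length `2⁻ⁿ`. -/
def dyadicPiece (τ : Ω → WithTop ℝ) (n : ℕ) (i : ℤ) : Set Ω :=
  {ω | τ ω < ((((i + 1 : ℤ) : ℝ) / 2 ^ n : ℝ) : WithTop ℝ)}
    \ {ω | τ ω < (((i : ℝ) / 2 ^ n : ℝ) : WithTop ℝ)}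

lemma mem_dyadicPiece_iff {τ : Ω → WithTop ℝ} {n : ℕ} {i : ℤ} {ω : Ω} :
    ω ∈ dyadicPiece τ n i ↔ τ ω ≠ ⊤ ∧ ⌊2 ^ n * (τ ω).untopA⌋ = i := by
  rw [dyadicPiece]
  cases hω : τ ω with
  | top => simp [hω]
  | coe s =>
    simp only [Set.mem_sdiff, Set.mem_ofPred_eq, hω, WithTop.coe_lt_coe, not_lt, ne_eq,
      WithTop.coe_ne_top, not_false_eq_true, true_and, WithTop.untopA, WithTop.untopD_coe,
      Int.floor_eq_iff]
    rw [lt_div_iff₀ (by positivity), div_le_iff₀ (by positivity), mul_comm s]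
    push_cast
    exact and_comm

lemma iUnion_dyadicPiece (τ : Ω → WithTop ℝ) (n : ℕ) :
    ⋃ i, dyadicPiece τ n i = {ω | τ ω ≠ ⊤} := by
  ext ω
  simp [mem_dyadicPiece_iff]

lemma pairwise_disjoint_dyadicPiece (τ : Ω → WithTop ℝ) (n : ℕ) :
    Pairwise (Function.onFun Disjoint (dyadicPiece τ n)) := by
  intro i j hij
  refine Set.disjoint_left.2 fun ω hi hj => hij ?_
  rw [mem_dyadicPiece_iff] at hi hj
  exact hi.2.symm.trans hj.2

lemma measurableSet_inter_dyadicPiece (hY : ∀ t, Measurable (Y t)) {τ : Ω → WithTop ℝ}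
    (hτ : IsStoppingTime (naturalPlus Y hY) τ) {A : Set Ω}
    (hA : MeasurableSet[hτ.measurableSpace] A) (n : ℕ) (i : ℤ) :
    MeasurableSet[past Y (((i + 1 : ℤ) : ℝ) / 2 ^ n)] (A ∩ dyadicPiece τ n i) := by
  have h1 := measurableSet_inter_lt hY hτ hA (((i + 1 : ℤ) : ℝ) / 2 ^ n)
  have h2 := measurableSet_inter_lt hY hτ (@MeasurableSet.univ _ hτ.measurableSpace) ((i : ℝ) / 2 ^ n)
  have hle : (i : ℝ) / 2 ^ n ≤ ((i + 1 : ℤ) : ℝ) / 2 ^ n := by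
    gcongr
    exact Int.le_add_one le_rfl
  rw [Set.univ_inter] at h2
  rw [dyadicPiece, ← Set.inter_sdiff_assoc]
  exact h1.diff (past_mono Y hle _ h2)

lemma map_restrict_iUnion_eq_comp {κ : Kernel ℝ ℝ} {A : ℤ → Set Ω}
    (hd : Pairwise (Function.onFun Disjoint A)) (hA : ∀ i, MeasurableSet (A i)) {U V : Ω → ℝ}
    {u v : ℤ → Ω → ℝ} (hUm : Measurable U) (hVm : Measurable V)
    (hU : ∀ i, ∀ ω ∈ A i, U ω = u i ω) (hV : ∀ i, ∀ ω ∈ A i, V ω = v i ω)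
    (h : ∀ i, (P.restrict (A i)).map (u i) = κ ∘ₘ (P.restrict (A i)).map (v i)) :
    (P.restrict (⋃ i, A i)).map U = κ ∘ₘ (P.restrict (⋃ i, A i)).map V := by
  rw [Measure.restrict_iUnion hd hA, Measure.map_sum hUm.aemeasurable,
    Measure.map_sum hVm.aemeasurable, Measure.bind_sum _ _ κ.aemeasurable]
  congr 1
  ext1 i
  rw [Measure.map_congr (ae_restrict_of_forall_mem (hA i) (hU i)),
    Measure.map_congr (ae_restrict_of_forall_mem (hA i) (hV i)), h i]

section

variable {S : Set ℝ} {κ : ℝ≥0 → Kernel S S}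

/-- On each dyadic piece the approximating time is the right endpoint, a deterministic time whose
past contains the piece. The pieces exhaust {τ ≠ ⊤}, so the arbitrary value of `untopA` at ⊤ plays
no role. -/
lemma map_dyadicAbove_eq_comp (hS : MeasurableSet S) (hY : ∀ t, Measurable (Y t))
    (hrc : RightContinuousPaths Y)
    (hmarkov : ∀ (s : ℝ) (t : ℝ≥0) (A : Set Ω), MeasurableSet[past Y s] A →
      (P.restrict A).map (Y (s + t)) = onRealKernel hS (κ t) ∘ₘ (P.restrict A).map (Y s))
    {τ : Ω → WithTop ℝ} (hτ : IsStoppingTime (naturalPlus Y hY) τ) {A : Set Ω}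
    (hA : MeasurableSet[hτ.measurableSpace] A) (t : ℝ≥0) (n : ℕ) :
    (P.restrict (A ∩ {ω | τ ω ≠ ⊤})).map (fun ω => Y (dyadicAbove n (τ ω).untopA + t) ω)
      = onRealKernel hS (κ t) ∘ₘ (P.restrict (A ∩ {ω | τ ω ≠ ⊤})).map
          (fun ω => Y (dyadicAbove n (τ ω).untopA) ω) := by
  have hm : Measurable fun ω => dyadicAbove n (τ ω).untopA := by
    have h1 : Measurable fun ω => ⌊2 ^ n * (τ ω).untopA⌋ :=
      Int.measurable_floor.comp (hτ.measurable'.untopA.const_mul _)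
    have h2 : Measurable fun i : ℤ => ((i + 1 : ℤ) : ℝ) / 2 ^ n := measurable_from_top
    exact h2.comp h1
  have hYm := measurable_eval_of_rightContinuous hY measurable_id hrc
  rw [← iUnion_dyadicPiece τ n, Set.inter_iUnion]
  refine map_restrict_iUnion_eq_comp
    (u := fun i => Y (((i + 1 : ℤ) : ℝ) / 2 ^ n + t)) (v := fun i => Y (((i + 1 : ℤ) : ℝ) / 2 ^ n))
    (fun i j hij => ?_)
    (fun i => past_le hY _ _ (measurableSet_inter_dyadicPiece hY hτ hA n i))
    (hYm.comp ((hm.add_const _).prodMk measurable_id)) (hYm.comp (hm.prodMk measurable_id))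
    (fun i ω hω => ?_) (fun i ω hω => ?_)
    fun i => hmarkov _ _ _ (measurableSet_inter_dyadicPiece hY hτ hA n i)
  · exact (pairwise_disjoint_dyadicPiece τ n hij).mono Set.inter_subset_right Set.inter_subset_right
  · rw [dyadicAbove, (mem_dyadicPiece_iff.1 hω.2).2]
  · rw [dyadicAbove, (mem_dyadicPiece_iff.1 hω.2).2]

lemma tendsto_integral_onReal
    (hcont : ∀ (t : ℝ≥0) (f : BoundedContinuousFunction ℝ ℝ),
      Continuous fun x : S => ∫ y, f y ∂κ t x)
    (t : ℝ≥0) (f : BoundedContinuousFunction ℝ ℝ) {v : ℕ → ℝ} {y : ℝ} (hv : ∀ n, v n ∈ S)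
    (hy : y ∈ S) (hlim : Tendsto v atTop (𝓝 y)) :
    Tendsto (fun n => ∫ z, f z ∂onReal (κ t) (v n)) atTop (𝓝 (∫ z, f z ∂onReal (κ t) y)) := by
  have key : ∀ x (hx : x ∈ S), ∫ z, f z ∂onReal (κ t) x = ∫ z, f z ∂κ t ⟨x, hx⟩ := fun x hx => by
    rw [onReal_of_mem _ hx, integral_map measurable_subtype_coe.aemeasurable
      f.continuous.aestronglyMeasurable]
  rw [key y hy]
  have h1 : Tendsto (fun n => (⟨v n, hv n⟩ : S)) atTop (𝓝 ⟨y, hy⟩) := tendsto_subtype_rng.2 hlim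
  exact (((hcont t f).tendsto _).comp h1).congr fun n => (key _ (hv n)).symm

variable [IsProbabilityMeasure P]

lemma ae_forall_mem_of_rightContinuous (hS : IsClosed S) (hrc : RightContinuousPaths Y)
    (hYS : ∀ t, ∀ᵐ ω ∂P, Y t ω ∈ S) : ∀ᵐ ω ∂P, ∀ t, Y t ω ∈ S := by
  have hdy : ∀ᵐ ω ∂P, ∀ q ∈ dyadic, Y q ω ∈ S :=
    (ae_ball_iff countable_dyadic).2 fun q _ => hYS q
  filter_upwards [hdy] with ω hω t
  exact hS.mem_of_tendsto ((hrc ω t).tendsto.comp (tendsto_dyadicAbove_Ici t))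
    (Eventually.of_forall fun n => hω _ (dyadicAbove_mem n t))

/-- Test the identity at the dyadic approximations with bounded continuous f and let the mesh go to
0. Right-continuity handles the left side; on the right side one also needs x ↦ ∫ f dκ_t(x, ·)
continuous on S, where almost every path stays. -/
lemma map_stoppedValue_eq_comp (hS : IsClosed S) [∀ t, IsMarkovKernel (κ t)]
    (hcont : ∀ (t : ℝ≥0) (f : BoundedContinuousFunction ℝ ℝ),
      Continuous fun x : S => ∫ y, f y ∂κ t x)
    (hY : ∀ t, Measurable (Y t)) (hrc : RightContinuousPaths Y) (hYS : ∀ t, ∀ᵐ ω ∂P, Y t ω ∈ S)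
    (hmarkov : ∀ (s : ℝ) (t : ℝ≥0) (A : Set Ω), MeasurableSet[past Y s] A →
      (P.restrict A).map (Y (s + t))
        = onRealKernel hS.measurableSet (κ t) ∘ₘ (P.restrict A).map (Y s))
    {τ : Ω → WithTop ℝ} (hτ : IsStoppingTime (naturalPlus Y hY) τ) {A : Set Ω}
    (hA : MeasurableSet[hτ.measurableSpace] A) (t : ℝ≥0) :
    (P.restrict (A ∩ {ω | τ ω ≠ ⊤})).map (fun ω => Y ((τ ω).untopA + t) ω)
      = onRealKernel hS.measurableSet (κ t) ∘ₘ (P.restrict (A ∩ {ω | τ ω ≠ ⊤})).map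
          (fun ω => Y (τ ω).untopA ω) := by
  set K := onRealKernel hS.measurableSet (κ t) with hK
  set ρ := P.restrict (A ∩ {ω | τ ω ≠ ⊤}) with hρ
  have hYm := measurable_eval_of_rightContinuous hY measurable_id hrc
  have hσ : Measurable fun ω => (τ ω).untopA := hτ.measurable'.untopA
  have hd : ∀ n, Measurable (dyadicAbove n) := fun n => by
    have h2 : Measurable fun i : ℤ => ((i + 1 : ℤ) : ℝ) / 2 ^ n := measurable_from_top
    exact h2.comp (Int.measurable_floor.comp (measurable_id.const_mul _))
  have hYσ : ∀ s : Ω → ℝ, Measurable s → Measurable fun ω => Y (s ω) ω := fun s hs =>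
    hYm.comp (hs.prodMk measurable_id)
  have hU := hYσ _ (hσ.add_const (t : ℝ))
  have hV := hYσ _ hσ
  have hUn : ∀ n, Measurable fun ω => Y (dyadicAbove n (τ ω).untopA + t) ω := fun n =>
    hYσ _ (((hd n).comp hσ).add_const (t : ℝ))
  have hVn : ∀ n, Measurable fun ω => Y (dyadicAbove n (τ ω).untopA) ω := fun n =>
    hYσ _ ((hd n).comp hσ)
  have : IsFiniteMeasure (ρ.map fun ω => Y ((τ ω).untopA + t) ω) := inferInstance
  have : IsFiniteMeasure (ρ.map fun ω => Y (τ ω).untopA ω) := inferInstance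
  have hcomp : ∀ (f : BoundedContinuousFunction ℝ ℝ) (v : Ω → ℝ), Measurable v →
      ∫ z, f z ∂(K ∘ₘ ρ.map v) = ∫ ω, ∫ z, f z ∂onReal (κ t) (v ω) ∂ρ := fun f v hv => by
    rw [integral_comp_measure (f.integrable _), integral_map hv.aemeasurable]
    · rfl
    · exact (f.continuous.stronglyMeasurable.integral_kernel (κ := K)).aestronglyMeasurable
  have hgm : ∀ (f : BoundedContinuousFunction ℝ ℝ) (v : Ω → ℝ), Measurable v →
      AEStronglyMeasurable (fun ω => ∫ z, f z ∂onReal (κ t) (v ω)) ρ := fun f v hv =>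
    ((f.continuous.stronglyMeasurable.integral_kernel (κ := K)).comp_measurable
      hv).aestronglyMeasurable
  have hae : ∀ᵐ ω ∂ρ, ∀ t, Y t ω ∈ S :=
    ae_restrict_of_ae (ae_forall_mem_of_rightContinuous hS hrc hYS)
  refine ext_of_forall_integral_eq_of_IsFiniteMeasure fun f => ?_
  have h1 : Tendsto (fun n => ∫ ω, f (Y (dyadicAbove n (τ ω).untopA + t) ω) ∂ρ) atTop
      (𝓝 (∫ ω, f (Y ((τ ω).untopA + t) ω) ∂ρ)) := by
    refine tendsto_integral_of_dominated_convergence (fun _ => ‖f‖)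
      (fun n => (f.continuous.measurable.comp (hUn n)).aestronglyMeasurable)
      (integrable_const _) (fun n => Eventually.of_forall fun ω => f.norm_coe_le_norm _)
      (Eventually.of_forall fun ω => ?_)
    refine (f.continuous.tendsto _).comp ((hrc ω _).tendsto.comp ?_)
    refine tendsto_nhdsWithin_iff.2 ⟨?_, Eventually.of_forall fun n =>
      add_le_add_left (lt_dyadicAbove n _).le _⟩
    exact ((tendsto_nhdsWithin_iff.1 (tendsto_dyadicAbove_Ici _)).1).add_const _
  have h2 : Tendsto (fun n => ∫ ω, ∫ z, f z ∂onReal (κ t) (Y (dyadicAbove n (τ ω).untopA) ω) ∂ρ)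
      atTop (𝓝 (∫ ω, ∫ z, f z ∂onReal (κ t) (Y (τ ω).untopA ω) ∂ρ)) := by
    refine tendsto_integral_of_dominated_convergence (fun _ => ‖f‖)
      (fun n => hgm f _ (hVn n)) (integrable_const _)
      (fun n => Eventually.of_forall fun ω => ?_) ?_
    · have := norm_integral_le_of_norm_le_const (μ := K (Y (dyadicAbove n (τ ω).untopA) ω))
        (f := f) (C := ‖f‖) (Eventually.of_forall f.norm_coe_le_norm)
      rw [probReal_univ, mul_one] at this
      exact this
    · filter_upwards [hae] with ω hω
      exact tendsto_integral_onReal hcont t f (fun n => hω _) (hω _)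
        ((hrc ω _).tendsto.comp (tendsto_dyadicAbove_Ici _))
  rw [hcomp f _ hV, integral_map hU.aemeasurable f.continuous.aestronglyMeasurable]
  refine tendsto_nhds_unique h1 (h2.congr fun n => ?_)
  rw [← hcomp f _ (hVn n), ← map_dyadicAbove_eq_comp hS.measurableSet hY hrc hmarkov hτ hA t n,
    integral_map (hUn n).aemeasurable f.continuous.aestronglyMeasurable]

/-- A right-continuous Markov process with Feller transition kernels is strong Markov. -/
theorem hasStrongMarkov (hS : IsClosed S) [∀ t, IsMarkovKernel (κ t)]
    (hcont : ∀ (t : ℝ≥0) (f : BoundedContinuousFunction ℝ ℝ),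
      Continuous fun x : S => ∫ y, f y ∂κ t x)
    (hY : ∀ t, Measurable (Y t)) (hrc : RightContinuousPaths Y) (hYS : ∀ t, ∀ᵐ ω ∂P, Y t ω ∈ S)
    (hmarkov : ∀ (s : ℝ) (t : ℝ≥0) (A : Set Ω), MeasurableSet[past Y s] A →
      (P.restrict A).map (Y (s + t))
        = onRealKernel hS.measurableSet (κ t) ∘ₘ (P.restrict A).map (Y s)) :
    HasStrongMarkov P Y hY fun t => onReal (κ t) := by
  intro τ hτ t B hB
  set K := onRealKernel hS.measurableSet (κ t) with hK
  have hle : hτ.measurableSpace ≤ mΩ := hτ.measurableSpace_le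
  have hV : Measurable[hτ.measurableSpace] fun ω => Y (τ ω).untopA ω :=
    measurable_stoppedValue (isStronglyProgressive hY hrc) hτ
  have hU : Measurable fun ω => Y ((τ ω).untopA + t) ω :=
    (measurable_eval_of_rightContinuous hY measurable_id hrc).comp
      ((hτ.measurable'.untopA.add_const (t : ℝ)).prodMk measurable_id)
  have htop : MeasurableSet[hτ.measurableSpace] {ω | τ ω ≠ ⊤} :=
    ((measurableSet_singleton _).preimage hτ.measurable).compl
  have hKm : Measurable fun y => (K y).real B := (K.measurable_coe hB).ennreal_toReal
  have hRm : Measurable[hτ.measurableSpace]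
      ({ω | τ ω ≠ ⊤}.indicator fun ω => (K (Y (τ ω).untopA ω)).real B) :=
    (hKm.comp hV).indicator htop
  have hEm : MeasurableSet {ω | τ ω ≠ ⊤ ∧ Y ((τ ω).untopA + t) ω ∈ B} :=
    (hle _ htop).inter (hU hB)
  have hbound : ∀ y, ‖(K y).real B‖ ≤ 1 := fun y => by
    rw [Real.norm_of_nonneg measureReal_nonneg]
    exact measureReal_le_one
  have hRint : Integrable ({ω | τ ω ≠ ⊤}.indicator fun ω => (K (Y (τ ω).untopA ω)).real B) P :=
    Integrable.indicator (Integrable.of_bound ((hKm.comp hV).mono hle le_rfl).aestronglyMeasurable 1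
      (Eventually.of_forall fun ω => hbound _)) (hle _ htop)
  refine (ae_eq_condExp_of_forall_setIntegral_eq hle ((integrable_const (1 : ℝ)).indicator hEm)
    (fun _ _ _ => hRint.integrableOn) (fun A hA _ => ?_)
    hRm.stronglyMeasurable.aestronglyMeasurable).symm
  have hmap := map_stoppedValue_eq_comp hS hcont hY hrc hYS hmarkov hτ hA t
  have hVm : Measurable fun ω => Y (τ ω).untopA ω := hV.mono hle le_rfl
  rw [setIntegral_indicator (hle _ htop), setIntegral_indicator hEm, setIntegral_const, smul_eq_mul,
    mul_one]
  set ρ := P.restrict (A ∩ {ω | τ ω ≠ ⊤}) with hρ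
  have h1 : P.real (A ∩ {ω | τ ω ≠ ⊤ ∧ Y ((τ ω).untopA + t) ω ∈ B})
      = ((ρ.map fun ω => Y ((τ ω).untopA + t) ω) B).toReal := by
    rw [Measure.map_apply hU hB, hρ, Measure.restrict_apply (hU hB), measureReal_def]
    congr 2
    ext ω
    simp only [Set.mem_inter_iff, Set.mem_ofPred_eq, Set.mem_preimage]
    tauto
  rw [h1, hmap, Measure.bind_apply hB K.aemeasurable, lintegral_map (K.measurable_coe hB) hVm,
    integral_eq_lintegral_of_nonneg_ae (Eventually.of_forall fun ω => measureReal_nonneg)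
      ((hKm.comp hVm).aestronglyMeasurable)]
  congr 1
  exact lintegral_congr fun ω => ofReal_measureReal

end

end StrongMarkov

/-! ### The Markov property of modifications -/

section Main

variable {Ω : Type*} [mΩ : MeasurableSpace Ω] {P : Measure Ω} [IsProbabilityMeasure P]
  {X Y : ℝ → Ω → ℝ} {μ : Measure ℝ} {η : ℝ≥0 → Kernel ℝ ℝ} {γ : ℕ → ℕ → ℝ≥0 → ℝ}
  {α : ℕ → ℝ} {h : ℕ → Polynomial ℝ}

/-- The sets that agree up to null sets with some event in the past of X form a σ-algebra, which
contains the generators of the past of Y. -/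
lemma IsModification.exists_past_ae_eq (hYX : IsModification P Y X) (s : ℝ) {A : Set Ω}
    (hA : MeasurableSet[past Y s] A) : ∃ A', MeasurableSet[past X s] A' ∧ A =ᵐ[P] A' := by
  have hle : past Y s ≤ eventuallyMeasurableSpace (past X s) (ae P) := by
    refine iSup₂_le fun r hr => ?_
    rintro _ ⟨B, hB, rfl⟩
    refine ⟨X r ⁻¹' B, measurable_past X hr hB, ?_⟩
    filter_upwards [hYX r] with ω hω
    exact congrArg B hω
  exact hle A hA

lemma IsModification.map_restrict_eq_comp (hX : IsSMPR P X μ η γ) (hYX : IsModification P Y X)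
    {κ : ℝ≥0 → Kernel μ.support μ.support} (hκ0 : κ 0 = Kernel.id)
    (hκ : ∀ t : ℝ≥0, 0 < t → ∀ᵐ y ∂μ, η t y = onReal (κ t) y) (s : ℝ) (t : ℝ≥0) {A : Set Ω}
    (hA : MeasurableSet[past Y s] A) :
    (P.restrict A).map (Y (s + t))
      = onRealKernel (measurableSet_support μ) (κ t) ∘ₘ (P.restrict A).map (Y s) := by
  rcases eq_zero_or_pos t with rfl | ht
  · rw [hκ0, onRealKernel_id_comp, NNReal.coe_zero, add_zero]
  obtain ⟨A', hA', hAA'⟩ := hYX.exists_past_ae_eq s hA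
  have hmap : ∀ r, (P.restrict A).map (Y r) = (P.restrict A').map (X r) := fun r => by
    rw [Measure.restrict_congr_set hAA', Measure.map_congr (ae_restrict_of_ae (hYX r))]
  rw [hmap, hmap, hX.map_restrict_eq_comp s ht hA']
  -- The two kernels agree only μ-almost everywhere; this suffices since the restricted law is
  -- absolutely continuous with respect to μ.
  have hac : (P.restrict A').map (X s) ≪ μ := by
    rw [← hX.law s]
    exact Measure.restrict_le_self.absolutelyContinuous.map (hX.measurable s)
  exact Measure.comp_congr (hac.ae_le (hκ t ht))

lemma IsFeller.continuous_integral {S : Set ℝ} [CompactSpace S] {κ : ℝ≥0 → Kernel S S}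
    (hκ : IsFeller κ) (t : ℝ≥0) (f : BoundedContinuousFunction ℝ ℝ) :
    Continuous fun x : S => ∫ y, f y ∂κ t x := by
  obtain ⟨g, hg⟩ := hκ.map_C0 t ⟨⟨fun x : S => f x, by fun_prop⟩, by simp [cocompact_eq_bot]⟩
  exact g.continuous.congr hg

end Main

end StatMarkov

end

theorem mainTheorem12 {Ω : Type*} [MeasurableSpace Ω] (P : Measure Ω) [IsProbabilityMeasure P]
    (X : ℝ → Ω → ℝ) (μ : Measure ℝ) (η : ℝ≥0 → Kernel ℝ ℝ) (γ : ℕ → ℕ → ℝ≥0 → ℝ)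
    (α : ℕ → ℝ) (h : ℕ → Polynomial ℝ)
    (hX : StatMarkov.IsRSMPR P X μ η γ α h)
    (hbdd : Bornology.IsBounded μ.support)
    (hsum : ∀ t : ℝ, 0 < t →
      Summable fun n : {n : ℕ // (n : ℕ∞) < StatMarkov.suppCard μ} =>
        Real.exp (-α n * t) * ⨆ x : μ.support, |(h n).eval (x : ℝ)|) :
    ∃ κ : ℝ≥0 → Kernel μ.support μ.support,
      -- the transition probabilities are Feller
      StatMarkov.IsFeller κ ∧
      (∀ t : ℝ≥0, 0 < t → ∀ᵐ y ∂μ, η t y = StatMarkov.onReal (κ t) y) ∧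
      -- the process has the strong Markov property
      (∃ Y : ℝ → Ω → ℝ, (∀ t, Measurable (Y t)) ∧ StatMarkov.IsModification P Y X ∧
        StatMarkov.RightContinuousPaths Y ∧ StatMarkov.LeftLimitPaths Y ∧
        ∀ t ω, Y t ω ∈ μ.support) ∧
      (∀ (Y : ℝ → Ω → ℝ) (hY : ∀ t, Measurable (Y t)), StatMarkov.IsModification P Y X →
        StatMarkov.RightContinuousPaths Y →
        StatMarkov.HasStrongMarkov P Y hY fun t => StatMarkov.onReal (κ t)) := by
  have hμ := hX.toIsSMPR.isProbabilityMeasure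
  have hc : CompactSpace μ.support := StatMarkov.compactSpace_support hbdd
  have hm := StatMarkov.isProbabilityMeasure_onSupport μ.measure_compl_support
  have hpos := StatMarkov.isOpenPosMeasure_onSupport μ
  have hspec := hX.isSpectralSystem hsum
  have hF := hspec.isFeller
  have hM := hF.markovKernel
  refine ⟨_, hF, ?_⟩
  have hη : ∀ t : ℝ≥0, 0 < t → ∀ᵐ y ∂μ, η t y = StatMarkov.onReal
      (StatMarkov.IsSpectralSystem.kernel (StatMarkov.onSupport μ)
        (fun n : {n : ℕ // (n : ℕ∞) < StatMarkov.suppCard μ} => (h n).toContinuousMapOn μ.support)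
        (fun n => α n) t) y := by
    intro t ht
    have hMη := hX.kernel t ht
    have hmom : ∀ᵐ y ∂μ, ∀ n : {n : ℕ // (n : ℕ∞) < StatMarkov.suppCard μ},
        ∫ z, (h n).eval z ∂η t y = Real.exp (-α n * t) * (h n).eval y :=
      ae_all_iff.2 fun n => hX.ae_integral_eval n.2 ht
    filter_upwards [hmom, StatMarkov.ae_compl_support_eq_zero hX.toIsSMPR ht,
      μ.support_mem_ae] with y hy hy0 hyS
    rw [StatMarkov.onReal_of_mem _ hyS, ← StatMarkov.map_onSupport hy0]
    have hp := StatMarkov.isProbabilityMeasure_onSupport hy0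
    congr 1
    -- Given mass only on the support, the transition probability is identified with the spectral
    -- kernel by its integrals of the `h n`.
    refine StatMarkov.measure_ext_of_dense hspec.dense fun n => ?_
    rw [hspec.integral_kernel_eigen]
    exact (StatMarkov.integral_onSupport hy0 fun z => (h n).eval z).trans (hy n)
  refine ⟨hη, hX.exists_modification hbdd, fun Y hY hYX hrc => ?_⟩
  refine StatMarkov.hasStrongMarkov Measure.isClosed_support hF.continuous_integral hY hrc
    (fun t => ?_) fun s t A hA => hYX.map_restrict_eq_comp hX.toIsSMPR hF.zero hη s t hA
  filter_upwards [hX.ae_mem_support t, hYX t] with ω h1 h2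
  rwa [h2]
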